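/- Let $E$ be a Radon space and let $(X,Y)=(\Omega,\mathcal F,(\mathcal F_t)_{t\ge0},(X_t,Y_t),\theta_t,\mathbf P_{(x,y)})$ be an $\mathbb R\times E$-valued right process without killing such that $X$ has càdlàg paths and $\mathbf E_{(x,y)}[f(X_t,Y_t)]=\mathbf E_{(0,y)}[f(X_t+x,Y_t)]$ for all $(x,y)\in\mathbb R\times E$, $t\ge0$ and measurable $f\ge0$ (a Markov additive process). Assume that $$\sup_{y\in E}\mathbf E_{(0,y)}\Big[\sup_{s\in[0,1]}|X_s|\Big]<\infty .$$ Let $\mathbf q:E\to(q_0,\infty)$ be measurable with $q_0>0$, let $\beta>1$, put $\mathfrak q(t)=\int_0^t\mathbf q(Y_s)\,ds$, and assume that, $\mathbf P_{(x,y)}$-a.s. for every $(x,y)$, $\mathfrak q(t)<\infty$ for all $t\ge0$. A strategy is a pair $\pi=(L^\pi,R^\pi)$ of $(\mathcal F_t)$-adapted processes with non-negative, non-decreasing, càdlàg paths such that, for every $(x,y)$, $\mathbf P_{(x,y)}$-a.s. $X_t-L^\pi_t+R^\pi_t\ge0$ for all $t\ge0$. It is admissible if $\mathbf E_{(x,y)}\big[\int_{[0,\infty)}e^{-\mathfrak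 q(t)}\,dR^\pi_t\big]<\infty$ for all $(x,y)$, where $L^\pi_{0-}=R^\pi_{0-}=0$. For admissible $\pi$ let $$v_\pi(x,y)=\mathbf E_{(x,y)}\Big[\int_{[0,\infty)}e^{-\mathfrak q(t)}\,dL^\pi_t\Big]-\beta\,\mathbf E_{(x,y)}\Big[\int_{[0,\infty)}e^{-\mathfrak q(t)}\,dR^\pi_t\Big].$$ The classical-classical value function is $V(x,y)=\sup_\pi v_\pi(x,y)$ over all admissible strategies. For $n\in\mathbb N$, the periodic-classical value function $V^{1/2^n}(x,y)$ with constant interval $2^{-n}$ is the supremum of $v_\pi(x,y)$ over those admissible $\pi$ for which there is a non-negative adapted process $\ell^\pi$ such that, for every $(x,y)$, $\mathbf P_{(x,y)}$-a.s. $L^\pi_t=\int_{[0,t]}\ell^\pi_s\,dN_s$ for all $t\ge0$, where $N_t=\max\{k\ge0:k2^{-n}\le t\}$; that is, dividends are paid only at the times $2^{-n},2\cdot2^{-n},3\cdot2^{-n},\dots$. Then for every $(x,y)\in\mathbb R\times E$ the values $V^{1/2^n}(x,y)$ and $V(x,y)$ are finite, the sequence $n\mapsto V^{1/2^n}(x,y)$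 is non-decreasing, and $$V^{1/2^n}(x,y)\uparrow V(x,y)\qquad(n\to\infty).$$ Moreover, for each $y\in E$ the function $x\mapsto V(x,y)$ is concave on $\mathbb R$. -/

import Mathlib

open Set Filter Topology MeasureTheory
open scoped NNReal ENNReal

/-! ### Universal measurability and Radon spaces -/

/-- The universal completion of a σ-algebra: the sets that are measurable for the completion of
every finite measure. -/
@[reducible] def universalCompletion (S : Type*) [MeasurableSpace S] : MeasurableSpace S where
  MeasurableSet' A := ∀ μ : Measure S, IsFiniteMeasure μ → NullMeasurableSet A μ
  measurableSet_empty := fun _ _ => nullMeasurableSet_empty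
  measurableSet_compl := fun _ hA μ hμ => (hA μ hμ).compl
  measurableSet_iUnion := fun _ hA μ hμ => NullMeasurableSet.iUnion fun i => hA i μ hμ

/-- A Radon space: a topological space homeomorphic to a universally measurable subspace of a
compact metrizable space. -/
def IsRadonSpace.{u} (E : Type u) [TopologicalSpace E] : Prop :=
  ∃ (K : Type u) (_ : TopologicalSpace K) (_ : CompactSpace K)
    (_ : TopologicalSpace.MetrizableSpace K) (_ : MeasurableSpace K) (_ : BorelSpace K)
    (e : E → K), IsEmbedding e ∧ MeasurableSet[universalCompletion K] (range e)

/-! ### Paths -/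

/-- Right-continuous paths with left limits, indexed by `[0, ∞)`. -/
def IsCadlag (g : ℝ≥0 → ℝ) : Prop :=
  ∀ t, ContinuousWithinAt g (Ici t) t ∧ ∃ l, Tendsto g (𝓝[<] t) (𝓝 l)

/-- Non-negative, non-decreasing càdlàg paths. -/
structure IsIncreasingPath (g : ℝ≥0 → ℝ) : Prop where
  nonneg : ∀ t, 0 ≤ g t
  mono : Monotone g
  cadlag : IsCadlag g

/-- The path `g` on `[0, ∞)`, extended to `ℝ` by the value `0` on `(-∞, 0)`, i.e. with the
convention `g (0-) = 0`. -/
noncomputable def extendPath (g : ℝ≥0 → ℝ) : ℝ → ℝ :=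
  fun t => if t < 0 then 0 else g t.toNNReal

lemma extendPath_mono {g : ℝ≥0 → ℝ} (hg : IsIncreasingPath g) : Monotone (extendPath g) := by
  intro s t hst
  unfold extendPath
  split_ifs with h1 h2 h2
  · exact le_rfl
  · exact hg.nonneg _
  · exact absurd (lt_of_le_of_lt hst h2) h1
  · exact hg.mono (Real.toNNReal_le_toNNReal hst)

lemma extendPath_rightCont {g : ℝ≥0 → ℝ} (hg : IsIncreasingPath g) (t : ℝ) :
    ContinuousWithinAt (extendPath g) (Ici t) t := by
  rcases lt_or_ge t 0 with ht | ht
  · have h : extendPath g =ᶠ[𝓝 t] fun _ => 0 := by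
      filter_upwards [Iio_mem_nhds ht] with s hs
      exact if_pos hs
    exact (continuousAt_const.congr h.symm).continuousWithinAt
  · have h1 : ContinuousWithinAt (fun s : ℝ => g s.toNNReal) (Ici t) t :=
      ContinuousWithinAt.comp (t := Ici t.toNNReal) (hg.cadlag t.toNNReal).1
        continuous_real_toNNReal.continuousWithinAt
        (fun s hs => Real.toNNReal_le_toNNReal hs)
    refine h1.congr (fun s hs => ?_) ?_
    · exact if_neg (not_lt.mpr (ht.trans hs))
    · exact if_neg (not_lt.mpr ht)

/-- The Lebesgue–Stieltjes measure `dg` of an increasing path `g`; it charges only `[0, ∞)`, and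
its mass at `0` is `g 0` because `g (0-) = 0`. -/
noncomputable def IsIncreasingPath.measure {g : ℝ≥0 → ℝ} (hg : IsIncreasingPath g) : Measure ℝ :=
  (StieltjesFunction.mk (extendPath g) (extendPath_mono hg) (extendPath_rightCont hg)).measure

/-! ### Right processes and Markov additive processes -/

/-- A right process without killing on the state space `S`, with its filtration `ℱ`, shifts `θ`
and laws `P z`, `z ∈ S`. The filtration may be any filtration for which the Markov property holds;
in particular it may be, but need not be, right-continuous and augmented by null sets. -/
structure RightProcess (Ω S : Type*) [mΩ : MeasurableSpace Ω] [TopologicalSpace S]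
    [mS : MeasurableSpace S] where
  ℱ : Filtration ℝ≥0 mΩ
  Z : ℝ≥0 → Ω → S
  θ : ℝ≥0 → Ω → Ω
  P : S → Measure Ω
  isProbabilityMeasure : ∀ z, IsProbabilityMeasure (P z)
  adapted : ∀ t, Measurable[ℱ t] (Z t)
  rightCont : ∀ ω t, ContinuousWithinAt (fun s => Z s ω) (Ici t) t
  shift : ∀ s t ω, Z s (θ t ω) = Z (t + s) ω
  normal : ∀ z, ∀ᵐ ω ∂(P z), Z 0 ω = z
  /-- `z ↦ P z A` is universally measurable for every event `A` generated by the process. -/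
  measurable_law : ∀ A : Set Ω, MeasurableSet[⨆ t, mS.comap (Z t)] A →
    Measurable[universalCompletion S] fun z => P z A
  /-- The Markov property with respect to `ℱ`. -/
  markov : ∀ (z : S) (s t : ℝ≥0) (f : S → ℝ≥0∞), Measurable f →
    ∀ A : Set Ω, MeasurableSet[ℱ t] A →
      ∫⁻ ω in A, f (Z (t + s) ω) ∂(P z) =
        ∫⁻ ω in A, (∫⁻ ω', f (Z s ω') ∂(P (Z t ω))) ∂(P z)
  /-- Every `α`-excessive function is almost surely right-continuous along the paths. -/
  rightCont_excessive : ∀ (α : ℝ) (f : S → ℝ≥0∞), 0 < α →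
    Measurable[universalCompletion S] f →
    (∀ (t : ℝ≥0) (z : S),
      ENNReal.ofReal (Real.exp (-α * t)) * ∫⁻ ω, f (Z t ω) ∂(P z) ≤ f z) →
    (∀ z : S, Tendsto
      (fun t : ℝ≥0 => ENNReal.ofReal (Real.exp (-α * t)) * ∫⁻ ω, f (Z t ω) ∂(P z))
      (𝓝[>] 0) (𝓝 (f z))) →
    ∀ z : S, ∀ᵐ ω ∂(P z), ∀ t, ContinuousWithinAt (fun s => f (Z s ω)) (Ici t) t

/-- A Markov additive process `(X, Y)`: an `ℝ × E`-valued right process whose first component is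
càdlàg and which has the additivity property in the first component. -/
structure MarkovAdditiveProcess (Ω E : Type*) [MeasurableSpace Ω] [TopologicalSpace E]
    [MeasurableSpace E] extends RightProcess Ω (ℝ × E) where
  cadlag : ∀ ω, IsCadlag fun t => (Z t ω).1
  additive : ∀ (x : ℝ) (y : E) (t : ℝ≥0) (f : ℝ × E → ℝ≥0∞), Measurable f →
    ∫⁻ ω, f (Z t ω) ∂(P (x, y)) = ∫⁻ ω, f ((Z t ω).1 + x, (Z t ω).2) ∂(P (0, y))

namespace MarkovAdditiveProcess

variable {Ω E : Type*} [MeasurableSpace Ω] [TopologicalSpace E] [MeasurableSpace E]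

/-- The additive component `X`. -/
def X (𝒳 : MarkovAdditiveProcess Ω E) (t : ℝ≥0) (ω : Ω) : ℝ := (𝒳.Z t ω).1

/-- The modulating component `Y`. -/
def Y (𝒳 : MarkovAdditiveProcess Ω E) (t : ℝ≥0) (ω : Ω) : E := (𝒳.Z t ω).2

/-- `sup_y E_{(0,y)} [ sup_{s ∈ [0,1]} |X_s| ] < ∞`. -/
def HasBoundedMeanSup (𝒳 : MarkovAdditiveProcess Ω E) : Prop :=
  (⨆ y : E, ∫⁻ ω, (⨆ s ∈ Icc (0 : ℝ≥0) 1, ENNReal.ofReal |𝒳.X s ω|) ∂(𝒳.P (0, y))) < ⊤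

/-- The integrated discount rate `𝔮(t) = ∫₀ᵗ q(Y_s) ds`. -/
noncomputable def discount (𝒳 : MarkovAdditiveProcess Ω E) (q : E → ℝ) (t : ℝ) (ω : Ω) : ℝ :=
  ∫ s in (0 : ℝ)..t, q (𝒳.Y s.toNNReal ω)

/-- `𝔮(t)` is a well-defined finite integral for all `t ≥ 0`, almost surely under every law. -/
def HasFiniteDiscount (𝒳 : MarkovAdditiveProcess Ω E) (q : E → ℝ) : Prop :=
  ∀ z, ∀ᵐ ω ∂(𝒳.P z), ∀ t : ℝ, 0 ≤ t →
    IntervalIntegrable (fun s => q (𝒳.Y s.toNNReal ω)) volume 0 t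

/-! ### Strategies and value functions -/

/-- A strategy: cumulative dividends `L` and cumulative capital injections `R`, such that the
controlled process `X - L + R` stays non-negative. -/
structure Strategy (𝒳 : MarkovAdditiveProcess Ω E) where
  L : ℝ≥0 → Ω → ℝ
  R : ℝ≥0 → Ω → ℝ
  L_path : ∀ ω, IsIncreasingPath fun t => L t ω
  R_path : ∀ ω, IsIncreasingPath fun t => R t ω
  L_adapted : ∀ t, Measurable[𝒳.ℱ t] (L t)
  R_adapted : ∀ t, Measurable[𝒳.ℱ t] (R t)
  controlled_nonneg : ∀ z, ∀ᵐ ω ∂(𝒳.P z), ∀ t, 0 ≤ 𝒳.X t ω - L t ω + R t ω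

variable {𝒳 : MarkovAdditiveProcess Ω E}

/-- `E_z [ ∫_{[0,∞)} e^{-𝔮(t)} dL_t ]`. -/
noncomputable def Strategy.dividendValue (π : Strategy 𝒳) (q : E → ℝ) (z : ℝ × E) : ℝ≥0∞ :=
  ∫⁻ ω, (∫⁻ t in Ici (0 : ℝ), ENNReal.ofReal (Real.exp (-𝒳.discount q t ω))
    ∂(π.L_path ω).measure) ∂(𝒳.P z)

/-- `E_z [ ∫_{[0,∞)} e^{-𝔮(t)} dR_t ]`. -/
noncomputable def Strategy.injectionValue (π : Strategy 𝒳) (q : E → ℝ) (z : ℝ × E) : ℝ≥0∞ :=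
  ∫⁻ ω, (∫⁻ t in Ici (0 : ℝ), ENNReal.ofReal (Real.exp (-𝒳.discount q t ω))
    ∂(π.R_path ω).measure) ∂(𝒳.P z)

/-- Admissibility: the expected discounted injections are finite for every starting point. -/
def Strategy.IsAdmissible (π : Strategy 𝒳) (q : E → ℝ) : Prop :=
  ∀ z, π.injectionValue q z < ⊤

/-- The expected net present value of an admissible strategy. -/
noncomputable def Strategy.npv (π : Strategy 𝒳) (q : E → ℝ) (β : ℝ) (z : ℝ × E) : EReal :=
  (π.dividendValue q z : EReal) - (β : EReal) * (π.injectionValue q z : EReal)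

end MarkovAdditiveProcess

/-- The renewal times `T_k = r_1 + ⋯ + r_k`; the interarrival time `r_{m+1}` is `r m`. -/
def renewalTime {Ω : Type*} (r : ℕ → Ω → ℝ≥0) (k : ℕ) (ω : Ω) : ℝ≥0 :=
  ∑ m ∈ Finset.range k, r m ω

/-- The renewal counting process `N_t = max {k : T_k ≤ t}`. -/
noncomputable def renewalCount {Ω : Type*} (r : ℕ → Ω → ℝ≥0) (t : ℝ≥0) (ω : Ω) : ℕ :=
  sSup {k | renewalTime r k ω ≤ t}

namespace MarkovAdditiveProcess

variable {Ω E : Type*} [MeasurableSpace Ω] [TopologicalSpace E] [MeasurableSpace E]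
  {𝒳 : MarkovAdditiveProcess Ω E}

/-- Dividends are paid only at the renewal times: `L_t = ∫_{[0,t]} ℓ_s dN_s` for a non-negative
adapted process `ℓ`, where `N` jumps by `1` at each of `T_1, T_2, …`. -/
def Strategy.IsPeriodic (π : Strategy 𝒳) (r : ℕ → Ω → ℝ≥0) : Prop :=
  ∃ ℓ : ℝ≥0 → Ω → ℝ, (∀ t, Measurable[𝒳.ℱ t] (ℓ t)) ∧ (∀ t ω, 0 ≤ ℓ t ω) ∧
    ∀ z, ∀ᵐ ω ∂(𝒳.P z), ∀ t,
      π.L t ω = ∑ k ∈ Finset.range (renewalCount r t ω), ℓ (renewalTime r (k + 1) ω) ω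

/-- The admissible strategies of the classical-classical setting. -/
def classicalStrategies (𝒳 : MarkovAdditiveProcess Ω E) (q : E → ℝ) : Set (Strategy 𝒳) :=
  {π | π.IsAdmissible q}

/-- The admissible strategies of the periodic-classical setting with interarrival times `r`. -/
def periodicStrategies (𝒳 : MarkovAdditiveProcess Ω E) (q : E → ℝ) (r : ℕ → Ω → ℝ≥0) :
    Set (Strategy 𝒳) :=
  {π | π.IsAdmissible q ∧ π.IsPeriodic r}

/-- The classical-classical value function `V`. -/
noncomputable def classicalValue (𝒳 : MarkovAdditiveProcess Ω E) (q : E → ℝ) (β : ℝ)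
    (z : ℝ × E) : EReal :=
  ⨆ π ∈ 𝒳.classicalStrategies q, π.npv q β z

/-- The periodic-classical value function with interarrival times `r`. -/
noncomputable def periodicValue (𝒳 : MarkovAdditiveProcess Ω E) (q : E → ℝ) (β : ℝ)
    (r : ℕ → Ω → ℝ≥0) (z : ℝ × E) : EReal :=
  ⨆ π ∈ 𝒳.periodicStrategies q r, π.npv q β z

/-- The periodic-classical value function with constant interarrival times `2⁻ⁿ`. -/
noncomputable def dyadicValue (𝒳 : MarkovAdditiveProcess Ω E) (q : E → ℝ) (β : ℝ) (n : ℕ)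
    (z : ℝ × E) : EReal :=
  𝒳.periodicValue q β (fun _ _ => (2 ^ n)⁻¹) z

end MarkovAdditiveProcess

/-! The discount factor at `t` is the mass of `[t, ∞)` under the measure with density
`discountDensity`, so Tonelli turns every expected discounted payment into the expected integral of
the cumulative process against that density (`lintegral_exp_discount_eq`). Values thereby become
monotone, linear functionals of `L` and `R`, and everything rests on this form.

Finiteness: the constraint gives `L ≤ R + X`, and `β > 1`, so no strategy earns more than the
discounted integral of the running supremum of `|X|`. Its mean grows at most linearly in time, by
the Markov property at integer times and the uniform bound on the mean over one unit of time, while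
the discounting measure decays like `exp (-q₀ t)` (`lintegral_density_mul_supAbs_lt_top`).

Dyadic limit: given `π`, hold its dividends back until the next grid time and keep its injections.
The new cumulative dividends lie below the old ones, so the constraint survives. As the grid is
refined they increase to `L` at every positive continuity point of `L`, hence almost everywhere, and
monotone convergence gives the value of `π`. Monotonicity in `n` holds because each grid contains
the coarser one.

Concavity: near-optimal strategies for `x₁` and `x₂` live on an abstract `Ω` under different laws,
and nothing on `Ω` translates the additive component, so they cannot be averaged there. They are
first projected onto path space. By the Markov property, the projection of an `ℱ t`-measurable
variable depends only on the path up to `t` (`exists_projection`), so projected dividends stay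
adapted. By conditional Jensen, the least injections they require cost no more than the original
ones (`lintegral_mul_shortfall_le`). On path space the law from `(x₁, y)` is a translate of the law
from `(x, y)` (`map_translate_law`); dividends combine linearly and the least injection is convex
(`injection_combine_le`). -/

/-! ### Discounting along a path -/

/-- The density `f(s) exp(-∫₀ˢ f)` of the discounting measure. -/
noncomputable def discountDensity (f : ℝ → ℝ) (s : ℝ) : ℝ≥0∞ :=
  ENNReal.ofReal (f s * Real.exp (-∫ u in (0 : ℝ)..s, f u))

lemma Real.abs_exp_neg_sub_exp_neg_le {a b : ℝ} (ha : 0 ≤ a) (hb : 0 ≤ b) :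
    |Real.exp (-a) - Real.exp (-b)| ≤ |a - b| := by
  wlog hab : a ≤ b generalizing a b
  · rw [abs_sub_comm, abs_sub_comm a]
    exact this hb ha (le_of_not_ge hab)
  have h1 : Real.exp (-b) ≤ Real.exp (-a) := Real.exp_le_exp.2 (by linarith)
  have h2 : Real.exp (-b) = Real.exp (-a) * Real.exp (a - b) := by
    rw [← Real.exp_add]; congr 1; ring
  have h3 := Real.add_one_le_exp (a - b)
  have h4 : Real.exp (-a) ≤ 1 := Real.exp_le_one_iff.2 (by linarith)
  have h5 := Real.exp_pos (-a)
  rw [abs_of_nonneg (by linarith), abs_of_nonpos (by linarith), h2]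
  nlinarith [mul_nonneg h5.le (sub_nonneg.2 hab), Real.exp_pos (a - b)]

section Discount

variable {f : ℝ → ℝ} {q₀ : ℝ}

lemma intervalIntegrable_of_forall_nonneg
    (hf : ∀ t, 0 ≤ t → IntervalIntegrable f volume 0 t) {s t : ℝ} (hs : 0 ≤ s) (ht : 0 ≤ t) :
    IntervalIntegrable f volume s t :=
  (hf s hs).symm.trans (hf t ht)

lemma mul_sub_le_integral (hq : ∀ s, q₀ < f s)
    (hf : ∀ t, 0 ≤ t → IntervalIntegrable f volume 0 t) {s t : ℝ} (hs : 0 ≤ s) (hst : s ≤ t) :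
    q₀ * (t - s) ≤ (∫ u in (0 : ℝ)..t, f u) - ∫ u in (0 : ℝ)..s, f u := by
  rw [intervalIntegral.integral_interval_sub_left (hf t (hs.trans hst)) (hf s hs)]
  have := intervalIntegral.integral_mono_on (μ := volume) (f := fun _ => q₀) (g := f) hst
    (by simp) (intervalIntegrable_of_forall_nonneg hf hs (hs.trans hst))
    (fun u _ => (hq u).le)
  simpa [mul_comm] using this

lemma integral_nonneg_of_lt (hq₀ : 0 < q₀) (hq : ∀ s, q₀ < f s) {t : ℝ} (ht : 0 ≤ t) :
    0 ≤ ∫ u in (0 : ℝ)..t, f u :=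
  intervalIntegral.integral_nonneg ht fun u _ => (hq₀.trans (hq u)).le

/-- The rate is only locally integrable, so the discount factor need not be differentiable
everywhere. Absolute continuity is enough for the fundamental theorem of calculus, and it passes
from the indefinite integral because `x ↦ exp (-x)` is 1-Lipschitz on `[0, ∞)`. -/
lemma absolutelyContinuous_exp_neg_integral (hq₀ : 0 < q₀) (hq : ∀ s, q₀ < f s)
    (hf : ∀ t, 0 ≤ t → IntervalIntegrable f volume 0 t) {s t : ℝ} (hs : 0 ≤ s) (hst : s ≤ t) :
    AbsolutelyContinuousOnInterval (fun x => Real.exp (-∫ u in (0 : ℝ)..x, f u)) s t := by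
  have h0 := ((hf t (hs.trans hst)).absolutelyContinuousOnInterval_intervalIntegral
    (c := 0) (by simp)).mono (c := s) (d := t)
      (by rw [uIcc_of_le hst, uIcc_of_le (hs.trans hst)]; exact Icc_subset_Icc hs le_rfl)
  rw [absolutelyContinuousOnInterval_iff] at h0 ⊢
  intro ε hε
  obtain ⟨δ, hδ, H⟩ := h0 ε hε
  refine ⟨δ, hδ, fun I hI hlt => lt_of_le_of_lt (Finset.sum_le_sum fun i hi => ?_) (H I hI hlt)⟩
  have hm := hI.1 i (by simpa using hi)
  rw [uIcc_of_le hst] at hm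
  rw [Real.dist_eq, Real.dist_eq]
  exact Real.abs_exp_neg_sub_exp_neg_le (integral_nonneg_of_lt hq₀ hq (hs.trans hm.1.1))
    (integral_nonneg_of_lt hq₀ hq (hs.trans hm.2.1))

lemma ae_deriv_exp_neg_integral
    (hf : ∀ t, 0 ≤ t → IntervalIntegrable f volume 0 t) {t : ℝ} (ht : 0 ≤ t) :
    ∀ᵐ x, x ∈ uIcc 0 t → deriv (fun x => Real.exp (-∫ u in (0 : ℝ)..x, f u)) x
      = -(f x * Real.exp (-∫ u in (0 : ℝ)..x, f u)) := by
  filter_upwards [(hf t ht).ae_hasDerivAt_integral] with x hx hxt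
  refine ((hx hxt 0 (by simp)).neg.exp).deriv.trans ?_
  simp [mul_comm]

lemma integral_mul_exp_neg_integral (hq₀ : 0 < q₀) (hq : ∀ s, q₀ < f s)
    (hf : ∀ t, 0 ≤ t → IntervalIntegrable f volume 0 t) {s t : ℝ} (hs : 0 ≤ s) (hst : s ≤ t) :
    IntervalIntegrable (fun x => f x * Real.exp (-∫ u in (0 : ℝ)..x, f u)) volume s t ∧
    ∫ x in s..t, f x * Real.exp (-∫ u in (0 : ℝ)..x, f u) =
      Real.exp (-∫ u in (0 : ℝ)..s, f u) - Real.exp (-∫ u in (0 : ℝ)..t, f u) := by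
  have hac := absolutelyContinuous_exp_neg_integral hq₀ hq hf hs hst
  have hsub : uIcc s t ⊆ uIcc 0 t := by
    rw [uIcc_of_le hst, uIcc_of_le (hs.trans hst)]; exact Icc_subset_Icc hs le_rfl
  refine ⟨(intervalIntegrable_of_forall_nonneg hf hs (hs.trans hst)).mul_continuousOn
    hac.continuousOn, ?_⟩
  have h := hac.integral_deriv_eq_sub
  rw [← neg_sub, ← h, ← intervalIntegral.integral_neg]
  refine intervalIntegral.integral_congr_ae ?_
  filter_upwards [ae_deriv_exp_neg_integral hf (hs.trans hst)] with x hx hxt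
  rw [hx (hsub (uIoc_subset_uIcc hxt)), neg_neg]

lemma tendsto_exp_neg_integral_atTop (hq₀ : 0 < q₀) (hq : ∀ s, q₀ < f s)
    (hf : ∀ t, 0 ≤ t → IntervalIntegrable f volume 0 t) :
    Tendsto (fun t => Real.exp (-∫ u in (0 : ℝ)..t, f u)) atTop (𝓝 0) := by
  refine Real.tendsto_exp_neg_atTop_nhds_zero.comp ?_
  refine tendsto_atTop_mono' _ ?_ (tendsto_id.const_mul_atTop hq₀)
  filter_upwards [eventually_ge_atTop 0] with t ht
  simpa using mul_sub_le_integral hq hf le_rfl ht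

/-- The discounting measure of `[t, ∞)` is the discount factor at `t`. -/
lemma setLIntegral_discountDensity_Ici (hq₀ : 0 < q₀) (hq : ∀ s, q₀ < f s)
    (hf : ∀ t, 0 ≤ t → IntervalIntegrable f volume 0 t) {t : ℝ} (ht : 0 ≤ t) :
    ∫⁻ s in Ici t, discountDensity f s = ENNReal.ofReal (Real.exp (-∫ u in (0 : ℝ)..t, f u)) := by
  rw [setLIntegral_congr (Ioi_ae_eq_Ici (μ := volume)).symm]
  set k : ℝ → ℝ := fun x => f x * Real.exp (-∫ u in (0 : ℝ)..x, f u) with hk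
  have hk0 : ∀ x, 0 ≤ k x := fun x => mul_nonneg (hq₀.trans (hq x)).le (Real.exp_pos _).le
  have hlim : Tendsto (fun T => ∫ x in t..T, k x) atTop
      (𝓝 (Real.exp (-∫ u in (0 : ℝ)..t, f u))) := by
    have h := (tendsto_exp_neg_integral_atTop hq₀ hq hf).const_sub
      (Real.exp (-∫ u in (0 : ℝ)..t, f u))
    rw [sub_zero] at h
    refine h.congr' ?_
    filter_upwards [eventually_ge_atTop t] with T hT
    exact ((integral_mul_exp_neg_integral hq₀ hq hf ht hT).2).symm
  have hint : IntegrableOn k (Ioi t) := by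
    refine integrableOn_Ioi_of_intervalIntegral_norm_tendsto (l := atTop) (b := id)
      (Real.exp (-∫ u in (0 : ℝ)..t, f u)) t (fun T => ?_) tendsto_id ?_
    · rcases le_total t T with hT | hT
      · exact (intervalIntegrable_iff_integrableOn_Ioc_of_le hT).1
          (integral_mul_exp_neg_integral hq₀ hq hf ht hT).1
      · simp [hT]
    · simpa only [Real.norm_of_nonneg (hk0 _)] using! hlim
  have := tendsto_nhds_unique (intervalIntegral_tendsto_integral_Ioi t hint tendsto_id) hlim
  rw [← this, ofReal_integral_eq_lintegral_ofReal hint (ae_of_all _ hk0)]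
  rfl

lemma setLIntegral_discountDensity_Ici_le (hq₀ : 0 < q₀) (hq : ∀ s, q₀ < f s)
    (hf : ∀ t, 0 ≤ t → IntervalIntegrable f volume 0 t) {t : ℝ} (ht : 0 ≤ t) :
    ∫⁻ s in Ici t, discountDensity f s ≤ ENNReal.ofReal (Real.exp (-(q₀ * t))) := by
  rw [setLIntegral_discountDensity_Ici hq₀ hq hf ht]
  refine ENNReal.ofReal_le_ofReal (Real.exp_le_exp.2 (neg_le_neg ?_))
  simpa using mul_sub_le_integral hq hf le_rfl ht

/-- On `[n, n + 1)` the monotone `h` is at most its value at `n + 1`, and the discounting measure of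
`[n, ∞)` is at most `exp (-q₀ n)`. -/
lemma setLIntegral_discountDensity_mul_le (hq₀ : 0 < q₀) (hq : ∀ s, q₀ < f s)
    (hf : ∀ t, 0 ≤ t → IntervalIntegrable f volume 0 t) {h : ℝ≥0 → ℝ≥0∞} (hh : Monotone h) :
    ∫⁻ s in Ici 0, discountDensity f s * h s.toNNReal ≤
      ∑' n : ℕ, ENNReal.ofReal (Real.exp (-(q₀ * n))) * h (n + 1) := by
  have hcov : Ici (0 : ℝ) ⊆ ⋃ n : ℕ, Ico (n : ℝ) (n + 1) := fun s hs =>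
    mem_iUnion.2 ⟨⌊s⌋₊, Nat.floor_le hs, Nat.lt_floor_add_one s⟩
  refine (lintegral_mono_set hcov).trans ((lintegral_iUnion_le _ _).trans ?_)
  refine ENNReal.tsum_le_tsum fun n => ?_
  calc ∫⁻ s in Ico (n : ℝ) (n + 1), discountDensity f s * h s.toNNReal
      ≤ ∫⁻ s in Ico (n : ℝ) (n + 1), discountDensity f s * h (n + 1) := by
        refine setLIntegral_mono' measurableSet_Ico fun s hs => ?_
        gcongr
        refine hh ?_
        rw [Real.toNNReal_le_iff_le_coe]
        simpa using hs.2.le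
    _ ≤ ∫⁻ s in Ici (n : ℝ), discountDensity f s * h (n + 1) :=
        lintegral_mono_set Ico_subset_Ici_self
    _ ≤ _ := by
        -- No measurability of the density is assumed here, so the constant can be pulled out only
        -- when it is finite; otherwise the right-hand side is infinite.
        by_cases hT : h (n + 1) = ⊤
        · rw [hT, ENNReal.mul_top (by simp [Real.exp_pos])]; exact le_top
        rw [lintegral_mul_const' _ _ hT]
        gcongr
        exact setLIntegral_discountDensity_Ici_le hq₀ hq hf n.cast_nonneg

/-- The endpoint of the integral is itself a variable. Writing the interval integral as a difference
of integrals of indicators over the whole line moves that variable into the integrand. -/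
lemma measurable_discountDensity_uncurry {α : Type*} [MeasurableSpace α] {f : α → ℝ → ℝ}
    (hf : Measurable fun p : α × ℝ => f p.1 p.2) :
    Measurable fun p : α × ℝ => discountDensity (f p.1) p.2 := by
  have h : ∀ p : α × ℝ, ∫ u in (0 : ℝ)..p.2, f p.1 u =
      (∫ u, (Ioc 0 p.2).indicator (f p.1) u) - ∫ u, (Ioc p.2 0).indicator (f p.1) u := fun p => by
    rw [integral_indicator measurableSet_Ioc, integral_indicator measurableSet_Ioc]
    rfl
  have hf' : Measurable fun r : (α × ℝ) × ℝ => f r.1.1 r.2 :=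
    hf.comp ((measurable_fst.comp measurable_fst).prodMk measurable_snd)
  have hs : Measurable fun r : (α × ℝ) × ℝ => r.1.2 := measurable_snd.comp measurable_fst
  have hm1 : Measurable fun r : (α × ℝ) × ℝ => (Ioc 0 r.1.2).indicator (f r.1.1) r.2 :=
    Measurable.ite ((measurableSet_lt measurable_const measurable_snd).inter
      (measurableSet_le measurable_snd hs)) hf' measurable_const
  have hm2 : Measurable fun r : (α × ℝ) × ℝ => (Ioc r.1.2 0).indicator (f r.1.1) r.2 :=
    Measurable.ite ((measurableSet_lt hs measurable_snd).inter
      (measurableSet_le measurable_snd measurable_const)) hf' measurable_const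
  refine (hf.mul (Measurable.exp (Measurable.neg ?_))).ennreal_ofReal
  simp_rw [h]
  exact (hm1.stronglyMeasurable.integral_prod_right').measurable.sub
    (hm2.stronglyMeasurable.integral_prod_right').measurable

lemma measurable_discountDensity (hfm : Measurable f) : Measurable (discountDensity f) :=
  (measurable_discountDensity_uncurry (α := Unit) (f := fun _ => f)
    (hfm.comp measurable_snd)).comp ((measurable_const (a := ())).prodMk measurable_id)

lemma IsIncreasingPath.measure_Icc_zero {g : ℝ≥0 → ℝ} (hg : IsIncreasingPath g) {s : ℝ}
    (hs : 0 ≤ s) : hg.measure (Icc 0 s) = ENNReal.ofReal (g s.toNNReal) := by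
  unfold IsIncreasingPath.measure
  rw [StieltjesFunction.measure_Icc]
  -- The extension vanishes on the negative half-line, so an initial jump `g 0` is counted as an
  -- atom at `0`.
  have h0 : Function.leftLim (extendPath g) 0 = 0 := by
    refine leftLim_eq_of_tendsto ?_
    refine tendsto_const_nhds.congr' ?_
    filter_upwards [self_mem_nhdsWithin] with t ht
    exact (if_pos ht).symm
  change ENNReal.ofReal (extendPath g s - Function.leftLim (extendPath g) 0) = _
  rw [h0, sub_zero, extendPath, if_neg (not_lt.2 hs)]

/-- Integration by parts: discounting the increments of `g` is the same as integrating `g`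
against the discounting measure. -/
lemma IsIncreasingPath.lintegral_exp_neg_integral (hq₀ : 0 < q₀) (hq : ∀ s, q₀ < f s)
    (hfm : Measurable f) (hf : ∀ t, 0 ≤ t → IntervalIntegrable f volume 0 t)
    {g : ℝ≥0 → ℝ} (hg : IsIncreasingPath g) :
    ∫⁻ t in Ici (0 : ℝ), ENNReal.ofReal (Real.exp (-∫ u in (0 : ℝ)..t, f u)) ∂hg.measure =
      ∫⁻ s in Ici (0 : ℝ), discountDensity f s * ENNReal.ofReal (g s.toNNReal) := by
  have hdm := measurable_discountDensity hfm
  have : SFinite hg.measure := by unfold IsIncreasingPath.measure; infer_instance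
  have hpair : Measurable (Function.uncurry fun t s : ℝ => (Ici t).indicator (discountDensity f) s) :=
    Measurable.ite (measurableSet_le measurable_fst measurable_snd)
      (hdm.comp measurable_snd) measurable_const
  calc ∫⁻ t in Ici (0 : ℝ), ENNReal.ofReal (Real.exp (-∫ u in (0 : ℝ)..t, f u)) ∂hg.measure
      = ∫⁻ t in Ici (0 : ℝ), (∫⁻ s in Ici (0 : ℝ), (Ici t).indicator (discountDensity f) s)
          ∂hg.measure := by
        refine setLIntegral_congr_fun measurableSet_Ici fun t ht => ?_
        rw [setLIntegral_indicator measurableSet_Ici, Ici_inter_Ici, sup_of_le_left ht,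
          setLIntegral_discountDensity_Ici hq₀ hq hf ht]
    _ = ∫⁻ s in Ici (0 : ℝ), (∫⁻ t in Ici (0 : ℝ), (Ici t).indicator (discountDensity f) s
          ∂hg.measure) := lintegral_lintegral_swap hpair.aemeasurable
    _ = _ := by
        -- After the swap, `t ≤ s` is read as a condition on `t`; the inner integral is then the
        -- mass of `[0, s]`, which is `g s`.
        refine setLIntegral_congr_fun measurableSet_Ici fun s hs => ?_
        have h : ∀ t : ℝ, (Ici t).indicator (discountDensity f) s =
            (Iic s).indicator (fun _ => discountDensity f s) t := fun t => by
          simp only [indicator, mem_Ici, mem_Iic]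
        simp_rw [h]
        rw [setLIntegral_indicator measurableSet_Iic, setLIntegral_const, inter_comm, Ici_inter_Iic,
          hg.measure_Icc_zero hs]

end Discount

/-! ### Dyadic grids -/

/-- The index of the last point of the grid `2⁻ⁿ ℕ` before `t`. -/
noncomputable def gridIndex (n : ℕ) (t : ℝ≥0) : ℕ := ⌊t * 2 ^ n⌋₊

/-- The `k`-th point of the grid `2⁻ⁿ ℕ`. -/
noncomputable def gridTime (n k : ℕ) : ℝ≥0 := k * (2 ^ n)⁻¹

lemma gridTime_mono (n : ℕ) : Monotone (gridTime n) := fun k l h => by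
  unfold gridTime; gcongr

lemma gridIndex_mono (n : ℕ) : Monotone (gridIndex n) := fun s t h =>
  Nat.floor_mono (by gcongr)

lemma le_gridIndex_iff {n k : ℕ} {t : ℝ≥0} : k ≤ gridIndex n t ↔ gridTime n k ≤ t := by
  unfold gridIndex gridTime
  rw [Nat.le_floor_iff (zero_le), mul_inv_le_iff₀ (by positivity)]

lemma gridTime_gridIndex_le (n : ℕ) (t : ℝ≥0) : gridTime n (gridIndex n t) ≤ t :=
  le_gridIndex_iff.1 le_rfl

lemma lt_gridTime_gridIndex_succ (n : ℕ) (t : ℝ≥0) : t < gridTime n (gridIndex n t + 1) := by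
  rw [← not_le, ← le_gridIndex_iff]; omega

lemma gridTime_succ (n k : ℕ) : gridTime n (k + 1) = gridTime n k + (2 ^ n)⁻¹ := by
  simp [gridTime, add_mul]

lemma gridTime_two_mul (n k : ℕ) : gridTime (n + 1) (2 * k) = gridTime n k := by
  unfold gridTime
  rw [pow_succ, mul_inv]; push_cast
  field_simp

lemma gridIndex_gridTime (n k : ℕ) : gridIndex n (gridTime n k) = k := by
  refine le_antisymm ?_ (le_gridIndex_iff.2 le_rfl)
  unfold gridIndex gridTime
  rw [inv_mul_cancel_right₀ (by positivity), Nat.floor_natCast]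

lemma gridTime_injective (n : ℕ) : Function.Injective (gridTime n) :=
  Function.LeftInverse.injective (gridIndex_gridTime n)

lemma gridTime_gridIndex_le_succ (n : ℕ) (t : ℝ≥0) :
    gridTime n (gridIndex n t) ≤ gridTime (n + 1) (gridIndex (n + 1) t) := by
  rw [← gridTime_two_mul]
  refine gridTime_mono _ (le_gridIndex_iff.2 ?_)
  rw [gridTime_two_mul]
  exact gridTime_gridIndex_le n t

lemma tendsto_gridTime_gridIndex (t : ℝ≥0) :
    Tendsto (fun n => gridTime n (gridIndex n t)) atTop (𝓝 t) := by
  have h : Tendsto (fun n : ℕ => t - ((2 : ℝ≥0) ^ n)⁻¹) atTop (𝓝 (t - 0)) := by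
    refine tendsto_const_nhds.sub ?_
    simp_rw [← inv_pow]
    exact tendsto_pow_atTop_nhds_zero_of_lt_one (by norm_num)
      (by rw [← NNReal.coe_lt_coe]; norm_num)
  rw [tsub_zero] at h
  refine tendsto_of_tendsto_of_tendsto_of_le_of_le h tendsto_const_nhds (fun n => ?_)
    (fun n => gridTime_gridIndex_le n t)
  rw [tsub_le_iff_right, ← gridTime_succ]
  exact (lt_gridTime_gridIndex_succ n t).le

/-- Grid points to the right of `t` are the ones along which right-continuous paths converge. Those
to the left preserve adaptedness, but reach only left limits at jumps. -/
lemma tendsto_gridTime_gridIndex_succ (t : ℝ≥0) :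
    Tendsto (fun n => gridTime n (gridIndex n t + 1)) atTop (𝓝[≥] t) := by
  rw [tendsto_nhdsWithin_iff]
  refine ⟨?_, .of_forall fun n => (lt_gridTime_gridIndex_succ n t).le⟩
  have h : Tendsto (fun n : ℕ => ((2 : ℝ≥0) ^ n)⁻¹) atTop (𝓝 0) := by
    simp_rw [← inv_pow]
    exact tendsto_pow_atTop_nhds_zero_of_lt_one (by norm_num)
      (by rw [← NNReal.coe_lt_coe]; norm_num)
  simpa [gridTime_succ] using (tendsto_gridTime_gridIndex t).add h

lemma eventually_gridIndex_eq (n : ℕ) (t : ℝ≥0) : ∀ᶠ s in 𝓝[≥] t, gridIndex n s = gridIndex n t := by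
  filter_upwards [self_mem_nhdsWithin,
    mem_nhdsWithin_of_mem_nhds (Iio_mem_nhds (lt_gridTime_gridIndex_succ n t))] with s hs hs'
  refine le_antisymm ?_ (gridIndex_mono n hs)
  by_contra! h
  exact (not_le.2 hs') (le_gridIndex_iff.1 h)

lemma measurable_gridIndex (n : ℕ) : Measurable (gridIndex n) :=
  (gridIndex_mono n).measurable

/-! ### Paths -/

lemma IsIncreasingPath.of_mono_rightCont {g : ℝ≥0 → ℝ} (h0 : ∀ t, 0 ≤ g t) (hg : Monotone g)
    (hc : ∀ t, ContinuousWithinAt g (Ici t) t) : IsIncreasingPath g :=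
  ⟨h0, hg, fun t => ⟨hc t, _, hg.tendsto_leftLim t⟩⟩

lemma isIncreasingPath_gridIndex (n : ℕ) {a : ℕ → ℝ} (h0 : ∀ k, 0 ≤ a k) (ha : Monotone a) :
    IsIncreasingPath fun t => a (gridIndex n t) :=
  .of_mono_rightCont (fun _ => h0 _) (ha.comp (gridIndex_mono n)) fun t =>
    tendsto_const_nhds.congr' <| by
      filter_upwards [eventually_gridIndex_eq n t] with s hs using by rw [hs]

/-- A monotone function has only countably many discontinuities, so approximation from the left
fails only on a null set. -/
lemma ae_tendsto_gridTime {g : ℝ≥0 → ℝ} (hg : Monotone g) :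
    ∀ᵐ t : ℝ, Tendsto (fun n => g (gridTime n (gridIndex n t.toNNReal))) atTop
      (𝓝 (g t.toNNReal)) := by
  have hm : Monotone fun t : ℝ => g t.toNNReal := hg.comp fun _ _ => Real.toNNReal_le_toNNReal
  filter_upwards [(hm.countable_not_continuousAt).ae_notMem volume] with t ht
  rw [not_not] at ht
  rcases le_total t 0 with h0 | h0
  · have : t.toNNReal = 0 := Real.toNNReal_of_nonpos h0
    rw [this]
    refine tendsto_const_nhds.congr fun n => ?_
    congr 1
    exact (le_antisymm (gridTime_gridIndex_le n 0) zero_le).symm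
  · have h1 : Tendsto (fun n => ((gridTime n (gridIndex n t.toNNReal) : ℝ≥0) : ℝ)) atTop (𝓝 t) := by
      have := (NNReal.continuous_coe.tendsto _).comp (tendsto_gridTime_gridIndex t.toNNReal)
      rwa [Real.coe_toNNReal t h0] at this
    have h2 := ht.tendsto.comp h1
    simpa only [Function.comp_def, Real.toNNReal_coe] using h2

/-- If a right-continuous function is outside a closed set at some `u < t`, it stays outside on an
interval to the right of `u`, which contains a point of the dense sequence. The endpoint `t` is
covered since `min (denseSeq i) t = t` for some `i`. This reduces suprema over `[0, t]` to countable
ones that use no time after `t`. -/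
lemma forall_le_mem_of_dense {β : Type*} [TopologicalSpace β] {g : ℝ≥0 → β}
    (hg : ∀ t, ContinuousWithinAt g (Ici t) t) {C : Set β} (hC : IsClosed C) {t : ℝ≥0}
    (h : ∀ i, g (min (TopologicalSpace.denseSeq ℝ≥0 i) t) ∈ C) {u : ℝ≥0} (hu : u ≤ t) : g u ∈ C := by
  by_contra hc
  rcases hu.eq_or_lt with rfl | hlt
  · obtain ⟨i, hi⟩ := (TopologicalSpace.denseRange_denseSeq ℝ≥0).exists_mem_open (isOpen_Ioi (a := u))
      ⟨u + 1, by simp⟩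
    have := h i
    rw [min_eq_right (mem_Ioi.1 hi).le] at this
    exact hc this
  · have h1 : ∀ᶠ s in 𝓝[≥] u, g s ∈ Cᶜ := (hg u).eventually (hC.isOpen_compl.mem_nhds hc)
    obtain ⟨v, hv, hsub⟩ := (mem_nhdsGE_iff_exists_Ico_subset' hlt).1 h1
    obtain ⟨i, hi⟩ := (TopologicalSpace.denseRange_denseSeq ℝ≥0).exists_mem_open (isOpen_Ioo (a := u) (b := min v t))
      (nonempty_Ioo.2 (lt_min hv hlt))
    have := h i
    rw [min_eq_left (hi.2.le.trans (min_le_right _ _))] at this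
    exact hsub ⟨hi.1.le, hi.2.trans_le (min_le_left _ _)⟩ this

/-- One-sided limits give a local bound near each point; compactness of `[0, t]` makes it global. -/
lemma IsCadlag.bddAbove_image {g : ℝ≥0 → ℝ} (hg : IsCadlag g) (t : ℝ≥0) :
    BddAbove (g '' Iic t) := by
  have hIcc : Iic t = Icc 0 t := by ext; simp
  rw [hIcc]
  refine isCompact_Icc.induction_on (p := fun s => BddAbove (g '' s)) (by simp)
    (fun s u hsu h => h.mono (image_mono hsu))
    (fun s u hs hu => by rw [image_union]; exact hs.union hu) fun u _ => ?_
  obtain ⟨hr, l, hl⟩ := hg u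
  have h1 : ∀ᶠ s in 𝓝[≥] u, g s ≤ g u + 1 := hr.eventually (Iic_mem_nhds (by linarith))
  have h2 : ∀ᶠ s in 𝓝[<] u, g s ≤ l + 1 := hl.eventually (Iic_mem_nhds (by linarith))
  have h3 : ∀ᶠ s in 𝓝 u, g s ≤ max (g u + 1) (l + 1) := by
    rw [← nhdsLT_sup_nhdsGE u, eventually_sup]
    exact ⟨h2.mono fun s hs => hs.trans (le_max_right _ _),
      h1.mono fun s hs => hs.trans (le_max_left _ _)⟩
  exact ⟨_, mem_nhdsWithin_of_mem_nhds h3, ⟨max (g u + 1) (l + 1), by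
    rintro _ ⟨s, hs, rfl⟩; exact hs⟩⟩

/-- The running supremum of the positive part of `g`. -/
noncomputable def runningSup (g : ℝ≥0 → ℝ) (t : ℝ≥0) : ℝ := ⨆ u : Iic t, max (g u) 0

lemma runningSup_le {g : ℝ≥0 → ℝ} {t : ℝ≥0} {c : ℝ} (hc : 0 ≤ c) (h : ∀ u ≤ t, g u ≤ c) :
    runningSup g t ≤ c :=
  ciSup_le fun u => max_le (h u u.2) hc

lemma runningSup_nonneg (g : ℝ≥0 → ℝ) (t : ℝ≥0) : 0 ≤ runningSup g t :=
  Real.iSup_nonneg fun _ => le_max_right _ _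

lemma IsCadlag.le_runningSup {g : ℝ≥0 → ℝ} (hg : IsCadlag g) {u t : ℝ≥0} (hu : u ≤ t) :
    g u ≤ runningSup g t := by
  obtain ⟨b, hb⟩ := hg.bddAbove_image t
  refine (le_max_left _ 0).trans (le_ciSup (f := fun u : Iic t => max (g u) 0) ?_ ⟨u, hu⟩)
  refine ⟨max b 0, ?_⟩
  rintro _ ⟨v, rfl⟩
  exact max_le_max (hb ⟨v, v.2, rfl⟩) le_rfl

lemma IsCadlag.isIncreasingPath_runningSup {g : ℝ≥0 → ℝ} (hg : IsCadlag g) :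
    IsIncreasingPath (runningSup g) := by
  have hmono : Monotone (runningSup g) := fun s t hst =>
    runningSup_le (runningSup_nonneg g t) fun u hu => hg.le_runningSup (hu.trans hst)
  refine .of_mono_rightCont (runningSup_nonneg g) hmono fun t => ?_
  refine (tendsto_order.2 ⟨fun a ha => ?_, fun a ha => ?_⟩)
  · filter_upwards [self_mem_nhdsWithin] with s hs using ha.trans_le (hmono hs)
  · obtain ⟨b, hb, hba⟩ := exists_between ha
    -- Right-continuity keeps `g` below `b` just after `t`, so the running supremum cannot jump
    -- there beyond `b`.
    have h1 : ∀ᶠ s in 𝓝[≥] t, g s ≤ b :=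
      (hg t).1.eventually (Iic_mem_nhds ((hg.le_runningSup le_rfl).trans_lt hb))
    obtain ⟨v, hv, hsub⟩ := mem_nhdsGE_iff_exists_Ico_subset.1 h1
    filter_upwards [Ico_mem_nhdsGE hv] with s hs
    refine lt_of_le_of_lt (runningSup_le ((runningSup_nonneg g t).trans hb.le) fun u hu => ?_) hba
    rcases le_total u t with hut | hut
    · exact (hg.le_runningSup hut).trans hb.le
    · exact hsub ⟨hut, hu.trans_lt hs.2⟩

lemma IsCadlag.runningSup_eq_iSup_dense {g : ℝ≥0 → ℝ} (hg : IsCadlag g) (t : ℝ≥0) :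
    runningSup g t = ⨆ i : ℕ, max (g (min (TopologicalSpace.denseSeq ℝ≥0 i) t)) 0 := by
  have hb : BddAbove (range fun i : ℕ => max (g (min (TopologicalSpace.denseSeq ℝ≥0 i) t)) 0) := by
    refine ⟨runningSup g t, ?_⟩
    rintro _ ⟨i, rfl⟩
    exact max_le (hg.le_runningSup (min_le_right _ _)) (runningSup_nonneg g t)
  refine le_antisymm (runningSup_le (Real.iSup_nonneg fun _ => le_max_right _ _) fun u hu => ?_)
    (ciSup_le fun i => max_le (hg.le_runningSup (min_le_right _ _)) (runningSup_nonneg g t))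
  exact forall_le_mem_of_dense (fun t => (hg t).1) isClosed_Iic
    (fun i => (le_max_left _ _).trans (le_ciSup hb i)) hu

lemma IsCadlag.sub {f g : ℝ≥0 → ℝ} (hf : IsCadlag f) (hg : IsCadlag g) :
    IsCadlag fun t => f t - g t := fun t =>
  ⟨(hf t).1.sub (hg t).1, _, (hf t).2.choose_spec.sub (hg t).2.choose_spec⟩

/-! ### Joint measurability -/

/-- The process is the pointwise limit of its values at the next grid time, and these involve only
countably many of the `Z t`. -/
lemma measurable_uncurry_of_rightCont {α β : Type*} [MeasurableSpace α] [TopologicalSpace β]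
    [TopologicalSpace.PseudoMetrizableSpace β] [MeasurableSpace β] [BorelSpace β]
    {Z : ℝ≥0 → α → β} (hm : ∀ t, Measurable (Z t))
    (hc : ∀ a t, ContinuousWithinAt (fun s => Z s a) (Ici t) t) :
    Measurable fun p : ℝ≥0 × α => Z p.1 p.2 := by
  refine measurable_of_tendsto_metrizable (f := fun n (p : ℝ≥0 × α) =>
    Z (gridTime n (gridIndex n p.1 + 1)) p.2) (fun n => ?_) (tendsto_pi_nhds.2 fun p => ?_)
  · have h : Measurable fun p : ℕ × α => Z (gridTime n (p.1 + 1)) p.2 :=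
      measurable_from_prod_countable_right fun k =>
      hm (gridTime n (k + 1))
    exact h.comp (((measurable_gridIndex n).comp measurable_fst).prodMk measurable_snd)
  · exact (hc p.2 p.1).tendsto.comp (tendsto_gridTime_gridIndex_succ p.1)

/-! ### Path space -/

/-- The space of right-continuous paths, with the σ-algebra generated by the coordinates. -/
abbrev PathSpace (S : Type*) [TopologicalSpace S] : Type _ :=
  {w : ℝ≥0 → S // ∀ t, ContinuousWithinAt w (Ici t) t}

namespace PathSpace

variable {S : Type*} [TopologicalSpace S]

/-- The path seen from time `t` on. -/
def shift (t : ℝ≥0) (w : PathSpace S) : PathSpace S :=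
  ⟨fun s => w.1 (t + s), fun s =>
    ContinuousWithinAt.comp (t := Ici (t + s)) (w.2 (t + s))
      (by fun_prop) (fun _ hu => by simpa using hu)⟩

variable [MeasurableSpace S]

lemma measurable_apply (t : ℝ≥0) : Measurable fun w : PathSpace S => w.1 t :=
  (measurable_pi_apply t).comp measurable_subtype_coe

lemma measurable_mk {α : Type*} [MeasurableSpace α] {Φ : α → PathSpace S}
    (h : ∀ t, Measurable fun a => (Φ a).1 t) : Measurable Φ :=
  (measurable_pi_lambda _ h).subtype_mk

lemma measurable_shift (t : ℝ≥0) : Measurable (shift (S := S) t) :=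
  measurable_mk fun s => measurable_apply (t + s)

/-- The σ-algebra generated by the path up to time `t`. -/
@[reducible] def past (S : Type*) [TopologicalSpace S] [mS : MeasurableSpace S] (t : ℝ≥0) :
    MeasurableSpace (PathSpace S) :=
  ⨆ s : Iic t, mS.comap fun w => w.1 s

lemma past_le (t : ℝ≥0) : past S t ≤ (inferInstance : MeasurableSpace (PathSpace S)) :=
  iSup_le fun s => (measurable_apply (s : ℝ≥0)).comap_le

lemma past_mono {s t : ℝ≥0} (h : s ≤ t) : past S s ≤ past S t :=
  iSup_le fun u => le_iSup (fun v : Iic t => MeasurableSpace.comap (fun w : PathSpace S => w.1 v) _)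
    ⟨u, u.2.trans h⟩

lemma measurable_past_apply {s t : ℝ≥0} (h : s ≤ t) :
    Measurable[past S t] fun w : PathSpace S => w.1 s :=
  (comap_measurable _).mono
    (le_iSup (fun v : Iic t => MeasurableSpace.comap (fun w : PathSpace S => w.1 v) _) ⟨s, h⟩) le_rfl

/-- The event that the path, at the times `i - c` for `i ∈ s`, visits the sets `B i`. -/
def visit (s : Finset ℝ≥0) (c : ℝ≥0) (B : ℝ≥0 → Set S) : Set (PathSpace S) :=
  {w | ∀ i ∈ s, w.1 (i - c) ∈ B i}

lemma measurableSet_visit (s : Finset ℝ≥0) (c : ℝ≥0) {B : ℝ≥0 → Set S}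
    (hB : ∀ i, MeasurableSet (B i)) : MeasurableSet (visit s c B) := by
  have : visit s c B = ⋂ i ∈ s, (fun w : PathSpace S => w.1 (i - c)) ⁻¹' B i := by
    ext; simp [visit]
  rw [this]
  exact s.measurableSet_biInter fun i _ => measurable_apply _ (hB i)

/-- The collection of finite-dimensional events. -/
def visitSets (S : Type*) [TopologicalSpace S] [MeasurableSpace S] : Set (Set (PathSpace S)) :=
  {A | ∃ (s : Finset ℝ≥0) (B : ℝ≥0 → Set S), (∀ i, MeasurableSet (B i)) ∧ A = visit s 0 B}

lemma visitSets_eq : visitSets S = (fun A => Subtype.val ⁻¹' A) ''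
    squareCylinders (fun _ : ℝ≥0 => {B : Set S | MeasurableSet B}) := by
  ext A
  constructor
  · rintro ⟨s, B, hB, rfl⟩
    refine ⟨_, ⟨s, B, fun i _ => hB i, rfl⟩, ?_⟩
    ext w; simp [visit, Set.mem_pi]
  · rintro ⟨_, ⟨s, B, hB, rfl⟩, rfl⟩
    refine ⟨s, B, fun i => hB i (mem_univ i), ?_⟩
    ext w; simp [visit, Set.mem_pi]

lemma isPiSystem_visitSets : IsPiSystem (visitSets S) := by
  classical
  rintro _ ⟨s, B, hB, rfl⟩ _ ⟨s', B', hB', rfl⟩ -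
  refine ⟨s ∪ s', fun i => (if i ∈ s then B i else univ) ∩ (if i ∈ s' then B' i else univ),
    fun i => ?_, ?_⟩
  · refine MeasurableSet.inter ?_ ?_ <;> split_ifs <;> simp [hB, hB']
  · ext w
    simp only [visit, mem_inter_iff, mem_ofPred_eq, Finset.mem_union, tsub_zero]
    constructor
    · rintro ⟨h1, h2⟩ i -
      constructor <;> split_ifs with h <;> simp [h1, h2, h]
    · intro h
      refine ⟨fun i hi => ?_, fun i hi => ?_⟩
      · simpa [hi] using (h i (.inl hi)).1
      · simpa [hi] using (h i (.inr hi)).2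

lemma generateFrom_visitSets :
    (inferInstance : MeasurableSpace (PathSpace S)) = MeasurableSpace.generateFrom (visitSets S) := by
  rw [visitSets_eq, ← MeasurableSpace.comap_generateFrom, generateFrom_squareCylinders]
  rfl

end PathSpace

/-! ### Universally measurable functions -/

lemma aemeasurable_of_universalCompletion {S : Type*} [MeasurableSpace S] {f : S → ℝ≥0∞}
    (hf : Measurable[universalCompletion S] f) (μ : Measure S) [IsFiniteMeasure μ] :
    AEMeasurable f μ :=
  NullMeasurable.aemeasurable fun _ hs => hf hs μ inferInstance

lemma Measurable.universalCompletion {S : Type*} [MeasurableSpace S] {f : S → ℝ≥0∞}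
    (hf : Measurable f) : Measurable[universalCompletion S] f :=
  fun _ hs _ _ => (hf hs).nullMeasurableSet

/-- Functions with the same integrals over the sets of a sub-σ-algebra have the same integrals
against the functions measurable for it. -/
lemma lintegral_mul_eq_of_setLIntegral_eq {α : Type*} {m m0 : MeasurableSpace α} (hm : m ≤ m0)
    {μ : Measure α} {G G' H : α → ℝ≥0∞} (hG : AEMeasurable G μ) (hG' : AEMeasurable G' μ)
    (hH : Measurable[m] H)
    (h : ∀ A, MeasurableSet[m] A → ∫⁻ a in A, G a ∂μ = ∫⁻ a in A, G' a ∂μ) :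
    ∫⁻ a, H a * G a ∂μ = ∫⁻ a, H a * G' a ∂μ := by
  have key : (μ.withDensity G).trim hm = (μ.withDensity G').trim hm := by
    refine @Measure.ext _ m _ _ fun A hA => ?_
    rw [trim_measurableSet_eq hm hA, trim_measurableSet_eq hm hA, withDensity_apply _ (hm _ hA),
      withDensity_apply _ (hm _ hA), h A hA]
  have hH' : AEMeasurable H μ := (hH.mono hm le_rfl).aemeasurable
  have e : ∀ {G : α → ℝ≥0∞}, AEMeasurable G μ →
      ∫⁻ a, H a * G a ∂μ = ∫⁻ a, H a ∂(μ.withDensity G).trim hm := fun {G} hG => by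
    rw [lintegral_trim hm hH, lintegral_withDensity_eq_lintegral_mul₀ hG hH']
    simp only [Pi.mul_apply, mul_comm]
  rw [e hG, e hG', key]

/-! ### The Markov property on path space -/

namespace RightProcess

variable {Ω S : Type*} [MeasurableSpace Ω] [TopologicalSpace S] [MeasurableSpace S]
  (𝒵 : RightProcess Ω S)

instance (z : S) : IsProbabilityMeasure (𝒵.P z) := 𝒵.isProbabilityMeasure z

/-- The path of the process. -/
def path (ω : Ω) : PathSpace S := ⟨fun t => 𝒵.Z t ω, 𝒵.rightCont ω⟩

lemma measurable_Z (t : ℝ≥0) : Measurable (𝒵.Z t) := (𝒵.adapted t).mono (𝒵.ℱ.le t) le_rfl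

lemma measurable_path : Measurable 𝒵.path := PathSpace.measurable_mk 𝒵.measurable_Z

lemma measurable_path_past (t : ℝ≥0) : @Measurable _ _ (𝒵.ℱ t) (PathSpace.past S t) 𝒵.path := by
  refine measurable_iff_comap_le.2 ?_
  rw [PathSpace.past, MeasurableSpace.comap_iSup]
  refine iSup_le fun s => ?_
  rw [MeasurableSpace.comap_comp]
  exact ((𝒵.adapted s).mono (𝒵.ℱ.mono s.2) le_rfl).comap_le

/-- The law of the path under `P z`. -/
noncomputable def law (z : S) : Measure (PathSpace S) := (𝒵.P z).map 𝒵.path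

instance (z : S) : IsProbabilityMeasure (𝒵.law z) :=
  Measure.isProbabilityMeasure_map 𝒵.measurable_path.aemeasurable

lemma measurable_law_apply {B : Set (PathSpace S)} (hB : MeasurableSet B) :
    Measurable[universalCompletion S] fun z => 𝒵.law z B := by
  have h : MeasurableSet[⨆ t, MeasurableSpace.comap (𝒵.Z t) inferInstance] (𝒵.path ⁻¹' B) := by
    refine (@PathSpace.measurable_mk S _ _ Ω (⨆ t, MeasurableSpace.comap (𝒵.Z t) inferInstance)
      𝒵.path fun t => ?_) hB
    exact (comap_measurable (𝒵.Z t)).mono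
      (le_iSup (fun t => MeasurableSpace.comap (𝒵.Z t) inferInstance) t) le_rfl
  have := 𝒵.measurable_law _ h
  simpa only [law, Measure.map_apply 𝒵.measurable_path hB] using this

lemma measurable_lintegral_law {F : PathSpace S → ℝ≥0∞} (hF : Measurable F) :
    Measurable[universalCompletion S] fun z => ∫⁻ w, F w ∂(𝒵.law z) :=
  (Measure.measurable_lintegral hF).comp
    (@Measure.measurable_of_measurable_coe _ _ _ (universalCompletion S) 𝒵.law
      fun _ hB => 𝒵.measurable_law_apply hB)

lemma aemeasurable_comp_Z {f : S → ℝ≥0∞} (hf : Measurable[universalCompletion S] f) (t : ℝ≥0)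
    (z : S) : AEMeasurable (fun ω => f (𝒵.Z t ω)) (𝒵.P z) := by
  have : IsFiniteMeasure ((𝒵.P z).map (𝒵.Z t)) := inferInstance
  exact (aemeasurable_of_universalCompletion hf _).comp_measurable (𝒵.measurable_Z t)

lemma lintegral_law (z : S) {F : PathSpace S → ℝ≥0∞} (hF : Measurable F) :
    ∫⁻ w, F w ∂(𝒵.law z) = ∫⁻ ω, F (𝒵.path ω) ∂(𝒵.P z) :=
  lintegral_map hF 𝒵.measurable_path

lemma measurable_lintegral_Z {f : S → ℝ≥0∞} (hf : Measurable f) (s : ℝ≥0) :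
    Measurable[universalCompletion S] fun z => ∫⁻ ω, f (𝒵.Z s ω) ∂(𝒵.P z) := by
  have := 𝒵.measurable_lintegral_law (hf.comp (PathSpace.measurable_apply s))
  simpa only [𝒵.lintegral_law _ (hf.comp (PathSpace.measurable_apply s))] using! this

/-- The Markov property for universally measurable functions. -/
lemma markov_universal (z : S) (s t : ℝ≥0) {f : S → ℝ≥0∞}
    (hf : Measurable[universalCompletion S] f) {A : Set Ω} (hA : MeasurableSet[𝒵.ℱ t] A) :
    ∫⁻ ω in A, f (𝒵.Z (t + s) ω) ∂(𝒵.P z) =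
      ∫⁻ ω in A, (∫⁻ ω', f (𝒵.Z s ω') ∂(𝒵.P (𝒵.Z t ω))) ∂(𝒵.P z) := by
  set ν := (𝒵.P z).map (𝒵.Z (t + s)) with hν
  have hfν : AEMeasurable f ν := aemeasurable_of_universalCompletion hf ν
  set g := hfν.mk f
  have hg : Measurable g := hfν.measurable_mk
  have hfg : f =ᵐ[ν] g := hfν.ae_eq_mk
  obtain ⟨N, hN, hNm, hN0⟩ := exists_measurable_superset_of_null (ae_iff.1 hfg)
  have hNi : Measurable (N.indicator fun _ => (1 : ℝ≥0∞)) := measurable_const.indicator hNm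
  have hs : ∀ z' : S, ∫⁻ ω', N.indicator (fun _ => (1 : ℝ≥0∞)) (𝒵.Z s ω') ∂(𝒵.P z')
      = 𝒵.P z' (𝒵.Z s ⁻¹' N) := fun z' =>
    (lintegral_indicator_one (𝒵.measurable_Z s hNm))
  -- The Borel version `g` agrees with `f` off `N`, a null set for the law of `Z (t + s)`. The inner
  -- expectations are under other laws; the Markov property for the indicator of `N` shows that `N`
  -- is negligible for almost all of these too.
  have h0 : ∀ᵐ ω ∂(𝒵.P z), 𝒵.P (𝒵.Z t ω) (𝒵.Z s ⁻¹' N) = 0 := by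
    have h := 𝒵.markov z s t _ hNi univ MeasurableSet.univ
    simp only [Measure.restrict_univ] at h
    rw [← lintegral_map hNi (𝒵.measurable_Z _), lintegral_indicator_const hNm, one_mul, hN0] at h
    have := (lintegral_eq_zero_iff' (𝒵.aemeasurable_comp_Z (𝒵.measurable_lintegral_Z hNi s) t z)).1
      h.symm
    filter_upwards [this] with ω hω
    rw [← hs]; exact hω
  have h1 : ∀ᵐ ω ∂(𝒵.P z), f (𝒵.Z (t + s) ω) = g (𝒵.Z (t + s) ω) :=
    ae_of_ae_map (𝒵.measurable_Z _).aemeasurable hfg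
  rw [lintegral_congr_ae (ae_restrict_of_ae h1), 𝒵.markov z s t g hg A hA]
  refine lintegral_congr_ae (ae_restrict_of_ae ?_)
  filter_upwards [h0] with ω hω
  refine lintegral_congr_ae ?_
  refine ae_iff.2 (measure_mono_null (fun ω' hω' => ?_) hω)
  exact hN fun h => hω' h.symm

/-- Induction on the number of times, splitting off the earliest one. The parameter `c` is the time
at which the clock was last restarted. The probability of the remaining visits is only a universally
measurable function of the state, hence the appeal to `markov_universal`. -/
lemma markov_visit (s : Finset ℝ≥0) {B : ℝ≥0 → Set S} (hB : ∀ i, MeasurableSet (B i)) :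
    ∀ (c : ℝ≥0), (∀ i ∈ s, c ≤ i) → ∀ (z : S) (t : ℝ≥0) (A : Set Ω), MeasurableSet[𝒵.ℱ t] A →
      𝒵.P z (A ∩ {ω | PathSpace.shift t (𝒵.path ω) ∈ PathSpace.visit s c B}) =
        ∫⁻ ω in A, 𝒵.law (𝒵.Z t ω) (PathSpace.visit s c B) ∂(𝒵.P z) := by
  induction s using Finset.induction_on_min with
  | empty => intro c _ z t A hA; simp [PathSpace.visit]
  | insert a s ha ih =>
    intro c hc z t A hA
    have hca : c ≤ a := hc a (Finset.mem_insert_self a s)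
    have has : ∀ i ∈ s, a ≤ i := fun i hi => (ha i hi).le
    have hmv := PathSpace.measurableSet_visit s a hB
    have htime : ∀ i ∈ s, a - c + (i - a) = i - c := fun i hi => by
      rw [add_comm]; exact tsub_add_tsub_cancel (has i hi) hca
    set φ : S → ℝ≥0∞ := fun z => (B a).indicator (fun z => 𝒵.law z (PathSpace.visit s a B)) z
    have hφ : Measurable[universalCompletion S] φ :=
      Measurable.indicator (𝒵.measurable_law_apply hmv)
        fun μ _ => (hB a).nullMeasurableSet
    have hset : ∀ t : ℝ≥0, {ω | PathSpace.shift t (𝒵.path ω) ∈ PathSpace.visit (insert a s) c B} =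
        {ω | 𝒵.Z (t + (a - c)) ω ∈ B a} ∩
          {ω | PathSpace.shift (t + (a - c)) (𝒵.path ω) ∈ PathSpace.visit s a B} := fun t => by
      ext ω
      simp only [PathSpace.visit, PathSpace.shift, path, Finset.mem_insert, forall_eq_or_imp,
        mem_ofPred_eq, mem_inter_iff]
      refine and_congr_right fun _ => forall₂_congr fun i hi => ?_
      rw [add_assoc, htime i hi]
    have step : ∀ (z : S) (t : ℝ≥0) (A : Set Ω), MeasurableSet[𝒵.ℱ t] A →
        𝒵.P z (A ∩ {ω | PathSpace.shift t (𝒵.path ω) ∈ PathSpace.visit (insert a s) c B}) =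
          ∫⁻ ω in A, φ (𝒵.Z (t + (a - c)) ω) ∂(𝒵.P z) := fun z t A hA => by
      have hZ : MeasurableSet[𝒵.ℱ (t + (a - c))] {ω | 𝒵.Z (t + (a - c)) ω ∈ B a} :=
        𝒵.adapted _ (hB a)
      rw [hset, ← inter_assoc, ih a has z (t + (a - c)) _
        ((𝒵.ℱ.mono le_self_add A hA).inter hZ)]
      rw [inter_comm, ← setLIntegral_indicator (𝒵.ℱ.le _ _ hZ)]
      rfl
    rw [step z t A hA, 𝒵.markov_universal z (a - c) t hφ hA]
    refine lintegral_congr fun ω => ?_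
    -- The same identity at time `0`, started from the current state, identifies the inner
    -- expectation.
    have h := step (𝒵.Z t ω) 0 univ MeasurableSet.univ
    rw [univ_inter, Measure.restrict_univ, zero_add] at h
    rw [← h, law, Measure.map_apply 𝒵.measurable_path (PathSpace.measurableSet_visit _ _ hB)]
    congr 1
    ext ω'
    simp [PathSpace.shift]

/-- The Markov property for path events. -/
lemma markov_path_set (z : S) (t : ℝ≥0) {A : Set Ω} (hA : MeasurableSet[𝒵.ℱ t] A)
    {B : Set (PathSpace S)} (hB : MeasurableSet B) :
    𝒵.P z (A ∩ {ω | PathSpace.shift t (𝒵.path ω) ∈ B}) =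
      ∫⁻ ω in A, 𝒵.law (𝒵.Z t ω) B ∂(𝒵.P z) := by
  have hmeas : ∀ {B : Set (PathSpace S)}, MeasurableSet B →
      MeasurableSet {ω | PathSpace.shift t (𝒵.path ω) ∈ B} := fun hB =>
    ((PathSpace.measurable_shift t).comp 𝒵.measurable_path) hB
  have hae : ∀ {B : Set (PathSpace S)}, MeasurableSet B →
      AEMeasurable (fun ω => 𝒵.law (𝒵.Z t ω) B) ((𝒵.P z).restrict A) := fun hB =>
    (𝒵.aemeasurable_comp_Z (𝒵.measurable_law_apply hB) t z).restrict
  induction B, hB using MeasurableSpace.induction_on_inter PathSpace.generateFrom_visitSets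
    PathSpace.isPiSystem_visitSets with
  | empty => simp
  | basic B hB =>
    obtain ⟨s, B, hB, rfl⟩ := hB
    exact 𝒵.markov_visit s hB 0 (fun i _ => zero_le) z t A hA
  | compl B hB ih =>
    have e : A ∩ {ω | PathSpace.shift t (𝒵.path ω) ∈ Bᶜ} =
        A \ (A ∩ {ω | PathSpace.shift t (𝒵.path ω) ∈ B}) := by ext; simp
    rw [e, measure_sdiff inter_subset_left
      ((𝒵.ℱ.le t A hA).inter (hmeas hB)).nullMeasurableSet (measure_ne_top _ _), ih]
    have h1 : ∀ ω, 𝒵.law (𝒵.Z t ω) Bᶜ = 1 - 𝒵.law (𝒵.Z t ω) B := fun ω => by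
      rw [measure_compl hB (measure_ne_top _ _), measure_univ]
    simp_rw [h1]
    rw [lintegral_sub' (hae hB) (by rw [← ih]; exact measure_ne_top _ _)
      (ae_of_all _ fun ω => prob_le_one)]
    simp
  | iUnion f hd hf ih =>
    have e : A ∩ {ω | PathSpace.shift t (𝒵.path ω) ∈ ⋃ i, f i} =
        ⋃ i, A ∩ {ω | PathSpace.shift t (𝒵.path ω) ∈ f i} := by
      ext; simp
    rw [e, measure_iUnion]
    · simp_rw [measure_iUnion hd hf, ih]
      rw [lintegral_tsum fun i => hae (hf i)]
    · intro i j hij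
      exact Disjoint.mono inter_subset_right inter_subset_right
        ((hd hij).preimage fun ω => PathSpace.shift t (𝒵.path ω))
    · exact fun i => (𝒵.ℱ.le t A hA).inter (hmeas (hf i))

lemma aemeasurable_lintegral_law {F : PathSpace S → ℝ≥0∞} (hF : Measurable F) (z : S) (t : ℝ≥0) :
    AEMeasurable (fun ω => ∫⁻ w, F w ∂(𝒵.law (𝒵.Z t ω))) (𝒵.P z) :=
  𝒵.aemeasurable_comp_Z (𝒵.measurable_lintegral_law hF) t z

lemma markov_path_setLIntegral (z : S) (t : ℝ≥0) {A : Set Ω} (hA : MeasurableSet[𝒵.ℱ t] A)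
    {F : PathSpace S → ℝ≥0∞} (hF : Measurable F) :
    ∫⁻ ω in A, F (PathSpace.shift t (𝒵.path ω)) ∂(𝒵.P z) =
      ∫⁻ ω in A, (∫⁻ w, F w ∂(𝒵.law (𝒵.Z t ω))) ∂(𝒵.P z) := by
  have hsh : Measurable fun ω => PathSpace.shift t (𝒵.path ω) :=
    (PathSpace.measurable_shift t).comp 𝒵.measurable_path
  have hcomp : ∀ {f : PathSpace S → ℝ≥0∞}, Measurable f →
    Measurable fun ω => f (PathSpace.shift t (𝒵.path ω)) := fun hf => hf.comp hsh
  refine Measurable.ennreal_induction (motive := fun F =>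
    ∫⁻ ω in A, F (PathSpace.shift t (𝒵.path ω)) ∂(𝒵.P z) =
      ∫⁻ ω in A, (∫⁻ w, F w ∂(𝒵.law (𝒵.Z t ω))) ∂(𝒵.P z))
    (fun c B hB => ?_) (fun f g _ hf hg h1 h2 => ?_) (fun f hf hm ih => ?_) hF
  · have h1 : ∀ ω, B.indicator (fun _ => c) (PathSpace.shift t (𝒵.path ω)) =
      {ω | PathSpace.shift t (𝒵.path ω) ∈ B}.indicator (fun _ => c) ω := fun ω => rfl
    simp_rw [h1]
    rw [lintegral_indicator_const (s := {ω | PathSpace.shift t (𝒵.path ω) ∈ B}) (hsh hB)]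
    simp_rw [lintegral_indicator_const hB]
    rw [lintegral_const_mul'' _
      (𝒵.aemeasurable_comp_Z (𝒵.measurable_law_apply hB) t z).restrict,
      ← 𝒵.markov_path_set z t hA hB, Measure.restrict_apply (t := {ω | PathSpace.shift t (𝒵.path ω) ∈ B}) (hsh hB), inter_comm]
  · simp only [Pi.add_apply]
    rw [lintegral_add_left (hcomp hf), h1, h2, ← lintegral_add_left'
      (𝒵.aemeasurable_lintegral_law hf z t).restrict]
    exact lintegral_congr fun ω => (lintegral_add_left hf _).symm
  · rw [lintegral_iSup (fun n => hcomp (hf n)) (fun i j hij ω => hm hij _)]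
    simp_rw [ih, lintegral_iSup hf hm]
    rw [lintegral_iSup' (fun n => (𝒵.aemeasurable_lintegral_law (hf n) z t).restrict)]
    exact ae_of_all _ fun ω i j hij => lintegral_mono (hm hij)

/-- The Markov property for path functionals. -/
lemma markov_path (z : S) (t : ℝ≥0) {H : Ω → ℝ≥0∞} (hH : Measurable[𝒵.ℱ t] H)
    {F : PathSpace S → ℝ≥0∞} (hF : Measurable F) :
    ∫⁻ ω, H ω * F (PathSpace.shift t (𝒵.path ω)) ∂(𝒵.P z) =
      ∫⁻ ω, H ω * (∫⁻ w, F w ∂(𝒵.law (𝒵.Z t ω))) ∂(𝒵.P z) :=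
  lintegral_mul_eq_of_setLIntegral_eq (𝒵.ℱ.le t)
    (hF.comp ((PathSpace.measurable_shift t).comp 𝒵.measurable_path)).aemeasurable
    (𝒵.aemeasurable_lintegral_law hF z t) hH
    fun _ hA => 𝒵.markov_path_setLIntegral z t hA hF

end RightProcess

/-! ### Translation, oscillation and discounting on path space -/

namespace PathSpace

variable {E : Type*} [TopologicalSpace E]

/-- Translation of the additive component by `x`. -/
def translate (x : ℝ) (w : PathSpace (ℝ × E)) : PathSpace (ℝ × E) :=
  ⟨fun t => ((w.1 t).1 + x, (w.1 t).2), fun t =>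
    ((w.2 t).fst.add continuousWithinAt_const).prodMk (w.2 t).snd⟩

lemma translate_translate (x x' : ℝ) (w : PathSpace (ℝ × E)) :
    translate x (translate x' w) = translate (x' + x) w :=
  Subtype.ext <| funext fun t => by simp [translate, add_assoc]

/-- The supremum of `|X|` on `[0, t]`. -/
noncomputable def supAbs (w : PathSpace (ℝ × E)) (t : ℝ≥0) : ℝ≥0∞ :=
  ⨆ u ≤ t, ENNReal.ofReal |(w.1 u).1|

lemma supAbs_mono (w : PathSpace (ℝ × E)) : Monotone (supAbs w) := fun _ _ h =>
  biSup_mono fun _ hu => hu.trans h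

lemma ofReal_abs_le_supAbs (w : PathSpace (ℝ × E)) {u t : ℝ≥0} (hu : u ≤ t) :
    ENNReal.ofReal |(w.1 u).1| ≤ supAbs w t :=
  le_iSup₂ (f := fun u (_ : u ≤ t) => ENNReal.ofReal |(w.1 u).1|) u hu

/-- The supremum of `|X - X₀|` on `[0, 1]`. -/
noncomputable def oscillation (w : PathSpace (ℝ × E)) : ℝ≥0∞ :=
  ⨆ i, ENNReal.ofReal
    |(w.1 (min (TopologicalSpace.denseSeq ℝ≥0 i) 1)).1 - (w.1 0).1|

lemma ofReal_abs_sub_le_oscillation (w : PathSpace (ℝ × E)) {u : ℝ≥0} (hu : u ≤ 1) :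
    ENNReal.ofReal |(w.1 u).1 - (w.1 0).1| ≤ oscillation w :=
  forall_le_mem_of_dense (g := fun u => ENNReal.ofReal |(w.1 u).1 - (w.1 0).1|)
    (fun t => ENNReal.continuous_ofReal.continuousAt.comp_continuousWithinAt
      ((w.2 t).fst.sub continuousWithinAt_const).abs)
    isClosed_Iic (fun i => le_iSup (fun i => ENNReal.ofReal
      |(w.1 (min (TopologicalSpace.denseSeq ℝ≥0 i) 1)).1 - (w.1 0).1|) i) hu

lemma oscillation_translate (x : ℝ) (w : PathSpace (ℝ × E)) :
    oscillation (translate x w) = oscillation w := by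
  simp [oscillation, translate]

/-- On each unit interval `|X|` exceeds its value at the left end by at most the oscillation.
Oscillations do not depend on the level, so their means can be bounded uniformly in the starting
point. -/
lemma supAbs_natCast_le (w : PathSpace (ℝ × E)) (n : ℕ) :
    supAbs w n ≤ ENNReal.ofReal |(w.1 0).1| +
      ∑ k ∈ Finset.range n, oscillation (shift (k : ℝ≥0) w) := by
  induction n with
  | zero => simp [supAbs]
  | succ n ih =>
    rw [Finset.sum_range_succ, ← add_assoc]
    refine le_trans (iSup₂_le fun u hu => ?_) (add_le_add_left ih _)
    rcases le_total u n with h | h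
    · exact (ofReal_abs_le_supAbs w h).trans le_self_add
    · have hu1 : u - n ≤ 1 := by
        rw [tsub_le_iff_left]; simpa using hu
      have h1 := ofReal_abs_sub_le_oscillation (shift (n : ℝ≥0) w) hu1
      simp only [shift, add_tsub_cancel_of_le h, add_zero] at h1
      calc ENNReal.ofReal |(w.1 u).1|
          ≤ ENNReal.ofReal (|(w.1 n).1| + |(w.1 u).1 - (w.1 n).1|) := by
            refine ENNReal.ofReal_le_ofReal ?_
            have := abs_add_le (w.1 n).1 ((w.1 u).1 - (w.1 n).1)
            rwa [add_sub_cancel] at this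
        _ ≤ _ := ENNReal.ofReal_add_le
        _ ≤ _ := add_le_add (ofReal_abs_le_supAbs w le_rfl) h1

/-- The discount rate along a path. -/
def rate (q : E → ℝ) (w : PathSpace (ℝ × E)) (s : ℝ) : ℝ := q (w.1 s.toNNReal).2

/-- The density of the discounting measure along a path. -/
noncomputable def density (q : E → ℝ) (w : PathSpace (ℝ × E)) (s : ℝ) : ℝ≥0∞ :=
  discountDensity (rate q w) s

lemma density_translate (q : E → ℝ) (x : ℝ) (w : PathSpace (ℝ × E)) (s : ℝ) :
    density q (translate x w) s = density q w s := rfl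

variable [MeasurableSpace E]

lemma measurable_translate (x : ℝ) : Measurable (translate (E := E) x) :=
  measurable_mk fun t => ((measurable_apply t).fst.add_const x).prodMk (measurable_apply t).snd

lemma measurable_translate_past (x : ℝ) (t : ℝ≥0) :
    @Measurable _ _ (past (ℝ × E) t) (past (ℝ × E) t) (translate x) := by
  refine measurable_iff_comap_le.2 ?_
  conv_lhs => rw [past, MeasurableSpace.comap_iSup]
  refine iSup_le fun s => ?_
  rw [MeasurableSpace.comap_comp]
  have h := measurable_past_apply (S := ℝ × E) s.2
  have h' : Measurable[past (ℝ × E) t]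
      ((fun w : PathSpace (ℝ × E) => w.1 s) ∘ translate x) :=
    ((measurable_fst.add_const x).prodMk measurable_snd).comp h
  exact h'.comap_le

lemma measurable_oscillation : Measurable (oscillation (E := E)) :=
  Measurable.iSup fun _ =>
    ((measurable_apply _).fst.sub (measurable_apply _).fst).abs.ennreal_ofReal

variable [BorelSpace E] [TopologicalSpace.PseudoMetrizableSpace E]

lemma measurable_rate {q : E → ℝ} (hq : Measurable q) :
    Measurable fun p : PathSpace (ℝ × E) × ℝ => rate q p.1 p.2 := by
  have h := measurable_uncurry_of_rightCont (α := PathSpace (ℝ × E)) (β := E)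
    (Z := fun t w => (w.1 t).2) (fun t => (measurable_apply t).snd) (fun w t => (w.2 t).snd)
  exact hq.comp (h.comp ((measurable_real_toNNReal.comp measurable_snd).prodMk measurable_fst))

lemma measurable_density {q : E → ℝ} (hq : Measurable q) :
    Measurable fun p : PathSpace (ℝ × E) × ℝ => density q p.1 p.2 :=
  measurable_discountDensity_uncurry (measurable_rate hq)

end PathSpace

/-- Metrizability is all that is needed of a Radon space: it makes pointwise limits of measurable
`E`-valued maps measurable. -/
lemma IsRadonSpace.metrizableSpace {E : Type*} [TopologicalSpace E] (hE : IsRadonSpace E) :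
    TopologicalSpace.MetrizableSpace E := by
  obtain ⟨K, _, _, _, _, _, e, he, -⟩ := hE
  exact he.metrizableSpace

/-! ### The law of a Markov additive process -/

lemma RightProcess.law_visit_insert {Ω S : Type*} [MeasurableSpace Ω] [TopologicalSpace S]
    [MeasurableSpace S] (𝒵 : RightProcess Ω S) {a c : ℝ≥0} {s : Finset ℝ≥0}
    (ha : ∀ i ∈ s, a ≤ i) (hca : c ≤ a) {B : ℝ≥0 → Set S} (hB : ∀ i, MeasurableSet (B i)) (z : S) :
    𝒵.law z (PathSpace.visit (insert a s) c B) =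
      ∫⁻ ω, (B a).indicator (fun z => 𝒵.law z (PathSpace.visit s a B)) (𝒵.Z (a - c) ω)
        ∂(𝒵.P z) := by
  have hZ : MeasurableSet[𝒵.ℱ (a - c)] (𝒵.Z (a - c) ⁻¹' B a) := 𝒵.adapted _ (hB a)
  have h := 𝒵.markov_visit s hB a ha z (a - c) _ hZ
  rw [← lintegral_indicator (𝒵.ℱ.le _ _ hZ)] at h
  refine Eq.trans ?_ h
  rw [law, Measure.map_apply 𝒵.measurable_path (PathSpace.measurableSet_visit _ _ hB)]
  congr 1
  ext ω
  simp only [PathSpace.visit, PathSpace.shift, path, Finset.mem_insert, forall_eq_or_imp,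
    mem_ofPred_eq, mem_inter_iff, mem_preimage]
  refine and_congr_right fun _ => forall₂_congr fun i hi => ?_
  rw [add_comm (a - c), tsub_add_tsub_cancel (ha i hi) hca]

namespace MarkovAdditiveProcess

variable {Ω E : Type*} [MeasurableSpace Ω] [TopologicalSpace E] [MeasurableSpace E]
  (𝒳 : MarkovAdditiveProcess Ω E)

lemma additive_universal (x : ℝ) (y : E) (t : ℝ≥0) {f : ℝ × E → ℝ≥0∞}
    (hf : Measurable[universalCompletion (ℝ × E)] f) :
    ∫⁻ ω, f (𝒳.Z t ω) ∂(𝒳.P (x, y)) =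
      ∫⁻ ω, f ((𝒳.Z t ω).1 + x, (𝒳.Z t ω).2) ∂(𝒳.P (0, y)) := by
  have hm : Measurable fun ω => ((𝒳.Z t ω).1 + x, (𝒳.Z t ω).2) :=
    ((𝒳.measurable_Z t).fst.add_const x).prodMk (𝒳.measurable_Z t).snd
  have h : (𝒳.P (x, y)).map (𝒳.Z t) =
      (𝒳.P (0, y)).map fun ω => ((𝒳.Z t ω).1 + x, (𝒳.Z t ω).2) := by
    refine Measure.ext_of_lintegral _ fun g hg => ?_
    rw [lintegral_map hg (𝒳.measurable_Z t), lintegral_map hg hm]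
    exact 𝒳.additive x y t g hg
  rw [← lintegral_map' (aemeasurable_of_universalCompletion hf _) (𝒳.measurable_Z t).aemeasurable,
    h, lintegral_map' (aemeasurable_of_universalCompletion hf _) hm.aemeasurable]

/-- Additivity is assumed at a single time only. The recursion `law_visit_insert` spreads it to
finitely many times, where the law of the later visits starts from a new level and must itself be
moved. -/
lemma law_visit_translate (s : Finset ℝ≥0) :
    ∀ (c : ℝ≥0), (∀ i ∈ s, c ≤ i) → ∀ (B : ℝ≥0 → Set (ℝ × E)), (∀ i, MeasurableSet (B i)) →
      ∀ (x : ℝ) (y : E), 𝒳.law (x, y) (PathSpace.visit s c B) =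
        𝒳.law (0, y) (PathSpace.visit s c fun i => {z | (z.1 + x, z.2) ∈ B i}) := by
  have htr : ∀ (x : ℝ) {B : ℝ≥0 → Set (ℝ × E)}, (∀ i, MeasurableSet (B i)) →
      ∀ i, MeasurableSet {z : ℝ × E | (z.1 + x, z.2) ∈ B i} := fun x B hB i =>
    ((measurable_fst.add_const x).prodMk measurable_snd) (hB i)
  induction s using Finset.induction_on_min with
  | empty => intro c _ B _ x y; simp [PathSpace.visit]
  | insert a s ha ih =>
    intro c hc B hB x y
    have hca : c ≤ a := hc a (Finset.mem_insert_self a s)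
    have has : ∀ i ∈ s, a ≤ i := fun i hi => (ha i hi).le
    rw [𝒳.law_visit_insert has hca hB, 𝒳.law_visit_insert has hca (htr x hB),
      𝒳.additive_universal x y]
    · refine lintegral_congr fun ω => ?_
      obtain ⟨x', y'⟩ := 𝒳.Z (a - c) ω
      simp only [indicator, mem_ofPred_eq]
      congr 1
      -- Both inner laws are brought to level `0`; the two successive translations then agree by
      -- associativity.
      rw [ih a has B hB, ih a has _ (htr x hB) x' y']
      congr! 4 with i
      ext z
      simp [add_assoc]
    · exact Measurable.indicator (𝒳.measurable_law_apply (PathSpace.measurableSet_visit s a hB))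
        fun μ _ => (hB a).nullMeasurableSet

lemma law_eq_map_zero (x : ℝ) (y : E) :
    𝒳.law (x, y) = (𝒳.law (0, y)).map (PathSpace.translate x) := by
  refine ext_of_generate_finite _ PathSpace.generateFrom_visitSets PathSpace.isPiSystem_visitSets
    ?_ ?_
  · rintro _ ⟨s, B, hB, rfl⟩
    rw [𝒳.law_visit_translate s 0 (fun _ _ => zero_le) B hB,
      Measure.map_apply (PathSpace.measurable_translate x) (PathSpace.measurableSet_visit s 0 hB)]
    rfl
  · rw [Measure.map_apply (PathSpace.measurable_translate x) MeasurableSet.univ]; simp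

/-- The law of the path under different starting levels. -/
lemma map_translate_law (x x' : ℝ) (y : E) :
    (𝒳.law (x, y)).map (PathSpace.translate (x' - x)) = 𝒳.law (x', y) := by
  rw [𝒳.law_eq_map_zero x, 𝒳.law_eq_map_zero x', Measure.map_map
    (PathSpace.measurable_translate _) (PathSpace.measurable_translate _)]
  congr 1
  ext1 w
  simp [PathSpace.translate_translate]

/-- The bound `sup_y E_{(0,y)} [sup_{s ≤ 1} |X_s|]`. -/
noncomputable def meanSup : ℝ≥0∞ :=
  ⨆ y : E, ∫⁻ ω, (⨆ s ∈ Icc (0 : ℝ≥0) 1, ENNReal.ofReal |𝒳.X s ω|) ∂(𝒳.P (0, y))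

/-- Translation invariance reduces to starting level `0`, where `X 0 = 0` almost surely and the
oscillation is at most the supremum of `|X|`. -/
lemma lintegral_oscillation_le (z : ℝ × E) :
    ∫⁻ w, PathSpace.oscillation w ∂(𝒳.law z) ≤ 𝒳.meanSup := by
  obtain ⟨x, y⟩ := z
  rw [𝒳.law_eq_map_zero, lintegral_map PathSpace.measurable_oscillation
    (PathSpace.measurable_translate x)]
  simp_rw [PathSpace.oscillation_translate]
  rw [𝒳.lintegral_law _ PathSpace.measurable_oscillation]
  refine le_trans (lintegral_mono_ae ?_) (le_iSup (fun y : E =>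
    ∫⁻ ω, (⨆ s ∈ Icc (0 : ℝ≥0) 1, ENNReal.ofReal |𝒳.X s ω|) ∂(𝒳.P (0, y))) y)
  filter_upwards [𝒳.normal (0, y)] with ω hω
  refine iSup_le fun i => ?_
  have h0 : ((𝒳.path ω).1 0).1 = 0 := congrArg Prod.fst hω
  rw [h0, sub_zero]
  exact le_iSup₂ (f := fun s (_ : s ∈ Icc (0 : ℝ≥0) 1) => ENNReal.ofReal |𝒳.X s ω|) _
    ⟨zero_le, min_le_right _ _⟩

lemma lintegral_oscillation_shift_le (z : ℝ × E) (t : ℝ≥0) :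
    ∫⁻ ω, PathSpace.oscillation (PathSpace.shift t (𝒳.path ω)) ∂(𝒳.P z) ≤ 𝒳.meanSup := by
  have h := 𝒳.markov_path_setLIntegral z t MeasurableSet.univ PathSpace.measurable_oscillation
  rw [Measure.restrict_univ] at h
  rw [h]
  calc _ ≤ ∫⁻ _, 𝒳.meanSup ∂(𝒳.P z) := lintegral_mono fun ω => 𝒳.lintegral_oscillation_le _
    _ = _ := by simp

lemma _root_.ENNReal.tsum_exp_neg_mul_lt_top {q₀ : ℝ} (hq₀ : 0 < q₀) {a c : ℝ≥0∞} (ha : a ≠ ⊤)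
    (hc : c ≠ ⊤) :
    ∑' n : ℕ, ENNReal.ofReal (Real.exp (-(q₀ * n))) * (a + (n + 1 : ℕ) * c) < ⊤ := by
  lift a to ℝ≥0 using ha
  lift c to ℝ≥0 using hc
  have h0 := Real.summable_pow_mul_exp_neg_nat_mul 0 hq₀
  have h1 := Real.summable_pow_mul_exp_neg_nat_mul 1 hq₀
  have h : Summable fun n : ℕ => Real.exp (-(q₀ * n)) * ((a : ℝ) + (n + 1) * c) := by
    refine ((h0.mul_right ((a : ℝ) + c)).add (h1.mul_right (c : ℝ))).congr fun n => ?_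
    simp only [pow_zero, pow_one, neg_mul]; ring
  refine lt_of_le_of_lt (le_of_eq ?_) h.tsum_ofReal_lt_top
  refine tsum_congr fun n => ?_
  rw [ENNReal.ofReal_mul (Real.exp_pos _).le]
  congr 1
  rw [ENNReal.ofReal_add (by positivity) (by positivity), ENNReal.ofReal_mul (by positivity),
    ENNReal.ofReal_coe_nnreal, ENNReal.ofReal_coe_nnreal]
  congr 2
  rw [← Nat.cast_succ, ENNReal.ofReal_natCast]

section Discount

variable {q : E → ℝ} {q₀ : ℝ}

lemma HasFiniteDiscount.ae_rate {𝒳 : MarkovAdditiveProcess Ω E} (hfin : 𝒳.HasFiniteDiscount q)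
    (z : ℝ × E) : ∀ᵐ ω ∂(𝒳.P z), ∀ t, 0 ≤ t →
      IntervalIntegrable (PathSpace.rate q (𝒳.path ω)) volume 0 t := hfin z

/-- Each unit interval adds at most `meanSup` to the mean of the running supremum, and the interval
`[n, n + 1)` is discounted by `exp (-q₀ n)`, so the series converges. -/
lemma lintegral_density_mul_supAbs_lt_top (hM : 𝒳.HasBoundedMeanSup) (hq₀ : 0 < q₀)
    (hq₀q : ∀ y, q₀ < q y) (hfin : 𝒳.HasFiniteDiscount q) {m : ℝ≥0∞} (hm : m ≠ ⊤) (z : ℝ × E) :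
    ∫⁻ ω, (∫⁻ s in Ici (0 : ℝ), PathSpace.density q (𝒳.path ω) s *
      (m + PathSpace.supAbs (𝒳.path ω) s.toNNReal)) ∂(𝒳.P z) < ⊤ := by
  have hX0 : Measurable fun ω => ENNReal.ofReal |((𝒳.path ω).1 0).1| :=
    (𝒳.measurable_Z 0).fst.abs.ennreal_ofReal
  have hosc : ∀ k : ℕ, Measurable fun ω =>
      PathSpace.oscillation (PathSpace.shift (k : ℝ≥0) (𝒳.path ω)) := fun k =>
    PathSpace.measurable_oscillation.comp ((PathSpace.measurable_shift _).comp 𝒳.measurable_path)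
  have hbound : ∀ n : ℕ, ∫⁻ ω, (m + (ENNReal.ofReal |((𝒳.path ω).1 0).1| +
      ∑ k ∈ Finset.range (n + 1), PathSpace.oscillation (PathSpace.shift (k : ℝ≥0) (𝒳.path ω))))
        ∂(𝒳.P z) ≤ (m + ENNReal.ofReal |z.1|) + (n + 1 : ℕ) * 𝒳.meanSup := fun n => by
    rw [lintegral_add_left measurable_const, lintegral_add_left hX0,
      lintegral_finsetSum _ fun k _ => hosc k, ← add_assoc]
    have e : ∫⁻ ω, ENNReal.ofReal |((𝒳.path ω).1 0).1| ∂(𝒳.P z) = ENNReal.ofReal |z.1| := by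
      rw [lintegral_congr_ae (g := fun _ => ENNReal.ofReal |z.1|)]
      · simp
      · filter_upwards [𝒳.normal z] with ω hω
        rw [show ((𝒳.path ω).1 0).1 = z.1 from congrArg Prod.fst hω]
    rw [e]
    simp only [lintegral_const, measure_univ, mul_one]
    gcongr
    calc _ ≤ ∑ k ∈ Finset.range (n + 1), 𝒳.meanSup :=
          Finset.sum_le_sum fun k _ => 𝒳.lintegral_oscillation_shift_le z k
      _ = _ := by simp
  refine lt_of_le_of_lt ?_ (ENNReal.tsum_exp_neg_mul_lt_top hq₀
    (a := m + ENNReal.ofReal |z.1|) (c := 𝒳.meanSup) (by simp [hm]) hM.ne)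
  calc _ ≤ ∫⁻ ω, ∑' n : ℕ, ENNReal.ofReal (Real.exp (-(q₀ * n))) *
        (m + (ENNReal.ofReal |((𝒳.path ω).1 0).1| + ∑ k ∈ Finset.range (n + 1),
          PathSpace.oscillation (PathSpace.shift (k : ℝ≥0) (𝒳.path ω)))) ∂(𝒳.P z) := by
        refine lintegral_mono_ae ?_
        filter_upwards [hfin.ae_rate z] with ω hω
        refine (setLIntegral_discountDensity_mul_le hq₀ (fun s => hq₀q _) hω
          (h := fun t => m + PathSpace.supAbs (𝒳.path ω) t)
          (fun _ _ h => add_le_add_right (PathSpace.supAbs_mono _ h) m)).trans ?_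
        refine ENNReal.tsum_le_tsum fun n => ?_
        gcongr
        exact_mod_cast PathSpace.supAbs_natCast_le (𝒳.path ω) (n + 1)
    _ ≤ _ := by
        rw [lintegral_tsum fun n => by fun_prop]
        refine ENNReal.tsum_le_tsum fun n => ?_
        rw [lintegral_const_mul _ (by fun_prop)]
        gcongr
        exact hbound n

variable [BorelSpace E] [TopologicalSpace.PseudoMetrizableSpace E]

lemma measurable_rate_path (hq : Measurable q) (ω : Ω) :
    Measurable (PathSpace.rate q (𝒳.path ω)) :=
  (PathSpace.measurable_rate hq).comp (measurable_const.prodMk measurable_id)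

variable {𝒳}

/-- The expected discounted value of an increasing process, by integration by parts. -/
lemma lintegral_exp_discount_eq (hq : Measurable q) (hq₀ : 0 < q₀)
    (hq₀q : ∀ y, q₀ < q y) (hfin : 𝒳.HasFiniteDiscount q) {G : ℝ≥0 → Ω → ℝ}
    (hG : ∀ ω, IsIncreasingPath fun t => G t ω) (z : ℝ × E) :
    ∫⁻ ω, (∫⁻ t in Ici (0 : ℝ), ENNReal.ofReal (Real.exp (-𝒳.discount q t ω)) ∂(hG ω).measure)
      ∂(𝒳.P z) =
    ∫⁻ ω, (∫⁻ s in Ici (0 : ℝ), PathSpace.density q (𝒳.path ω) s *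
      ENNReal.ofReal (G s.toNNReal ω)) ∂(𝒳.P z) := by
  refine lintegral_congr_ae ?_
  filter_upwards [hfin.ae_rate z] with ω hω
  exact (hG ω).lintegral_exp_neg_integral hq₀ (fun s => hq₀q _) (𝒳.measurable_rate_path hq ω) hω

end Discount

end MarkovAdditiveProcess

/-! ### Projection onto the path -/

namespace PathSpace

variable {S : Type*} [TopologicalSpace S] [MeasurableSpace S]

/-- The events that split into a condition on the past and one on the future at time `t`. -/
def pastFutureSets (S : Type*) [TopologicalSpace S] [MeasurableSpace S] (t : ℝ≥0) :
    Set (Set (PathSpace S)) :=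
  {A | ∃ B₁ B₂, MeasurableSet[past S t] B₁ ∧ MeasurableSet B₂ ∧ A = B₁ ∩ shift t ⁻¹' B₂}

lemma isPiSystem_pastFutureSets (t : ℝ≥0) : IsPiSystem (pastFutureSets S t) := by
  rintro _ ⟨B₁, B₂, h₁, h₂, rfl⟩ _ ⟨C₁, C₂, h₁', h₂', rfl⟩ -
  exact ⟨B₁ ∩ C₁, B₂ ∩ C₂, h₁.inter h₁', h₂.inter h₂', by
    rw [preimage_inter, inter_inter_inter_comm]⟩

lemma generateFrom_pastFutureSets (t : ℝ≥0) :
    (inferInstance : MeasurableSpace (PathSpace S)) =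
      MeasurableSpace.generateFrom (pastFutureSets S t) := by
  refine le_antisymm ?_ (MeasurableSpace.generateFrom_le ?_)
  · have h : @Measurable _ _ (MeasurableSpace.generateFrom (pastFutureSets S t)) _
        (id : PathSpace S → PathSpace S) := by
      refine @measurable_mk S _ _ _ (MeasurableSpace.generateFrom (pastFutureSets S t)) _ fun s => ?_
      intro A hA
      refine MeasurableSpace.measurableSet_generateFrom ?_
      rcases le_total s t with hst | hst
      · exact ⟨_, univ, measurable_past_apply hst hA, MeasurableSet.univ, by simp⟩
      · refine ⟨univ, _, MeasurableSet.univ, measurable_apply (s - t) hA, ?_⟩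
        ext w
        simp [shift, add_tsub_cancel_of_le hst]
    exact fun A hA => h hA
  · rintro _ ⟨B₁, B₂, h₁, h₂, rfl⟩
    exact (past_le t _ h₁).inter (measurable_shift t h₂)

end PathSpace

namespace RightProcess

variable {Ω S : Type*} [MeasurableSpace Ω] [TopologicalSpace S] [MeasurableSpace S]
  (𝒵 : RightProcess Ω S)

/-- Given the past, the conditional probability of a future event is a function of the path. -/
lemma exists_past_measurable (z : S) (t : ℝ≥0) {B₁ B₂ : Set (PathSpace S)}
    (h₁ : MeasurableSet[PathSpace.past S t] B₁) (h₂ : MeasurableSet B₂) :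
    ∃ Φ : PathSpace S → ℝ≥0∞, Measurable[PathSpace.past S t] Φ ∧
      ∀ K : Ω → ℝ≥0∞, Measurable[𝒵.ℱ t] K →
        ∫⁻ ω, K ω * (B₁ ∩ PathSpace.shift t ⁻¹' B₂).indicator 1 (𝒵.path ω) ∂(𝒵.P z) =
          ∫⁻ ω, K ω * Φ (𝒵.path ω) ∂(𝒵.P z) := by
  have hψ := aemeasurable_of_universalCompletion (𝒵.measurable_law_apply h₂)
    ((𝒵.P z).map (𝒵.Z t))
  -- A Borel version under the law of `Z t` makes `Φ` measurable with respect to the past.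
  set g := hψ.mk _ with hg
  have hgm : Measurable g := hψ.measurable_mk
  have hae : ∀ᵐ ω ∂(𝒵.P z), 𝒵.law (𝒵.Z t ω) B₂ = g (𝒵.Z t ω) :=
    ae_of_ae_map (𝒵.measurable_Z t).aemeasurable hψ.ae_eq_mk
  have hind : Measurable[PathSpace.past S t] (B₁.indicator (1 : PathSpace S → ℝ≥0∞)) :=
    measurable_const.indicator h₁
  refine ⟨fun w => B₁.indicator 1 w * g (w.1 t),
    hind.mul (hgm.comp (PathSpace.measurable_past_apply le_rfl)), fun K hK => ?_⟩
  have hKi : Measurable[𝒵.ℱ t] fun ω => K ω * B₁.indicator 1 (𝒵.path ω) :=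
    hK.mul (hind.comp (𝒵.measurable_path_past t))
  have hm := 𝒵.markov_path z t hKi (F := B₂.indicator 1) (measurable_one.indicator h₂)
  calc _ = ∫⁻ ω, K ω * B₁.indicator 1 (𝒵.path ω) *
        B₂.indicator 1 (PathSpace.shift t (𝒵.path ω)) ∂(𝒵.P z) := by
        refine lintegral_congr fun ω => ?_
        rw [mul_assoc, inter_indicator_one]
        rfl
    _ = _ := hm
    _ = _ := by
        refine lintegral_congr_ae ?_
        filter_upwards [hae] with ω hω
        rw [lintegral_indicator_one h₂, hω, mul_assoc]
        rfl

/-- The projection of a bounded `ℱ t`-measurable variable onto the path is measurable with respect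
to the path up to time `t`. -/
lemma exists_projection (z : S) (t : ℝ≥0) {H : Ω → ℝ≥0∞} (hH : Measurable[𝒵.ℱ t] H) {m : ℝ≥0∞}
    (hm : m ≠ ⊤) (hHm : ∀ ω, H ω ≤ m) :
    ∃ M : PathSpace S → ℝ≥0∞, Measurable[PathSpace.past S t] M ∧
      ∀ F : PathSpace S → ℝ≥0∞, Measurable F →
        ∫⁻ ω, H ω * F (𝒵.path ω) ∂(𝒵.P z) = ∫⁻ w, M w * F w ∂(𝒵.law z) := by
  have hHm0 : Measurable H := hH.mono (𝒵.ℱ.le t) le_rfl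
  have hfinH : IsFiniteMeasure ((𝒵.P z).withDensity H) :=
    isFiniteMeasure_withDensity (ne_top_of_le_ne_top hm
      ((lintegral_mono hHm).trans (by simp)))
  have hple := PathSpace.past_le (S := S) t
  set ν : Measure (PathSpace S) := ((𝒵.P z).withDensity H).map 𝒵.path with hν
  have hfinν : IsFiniteMeasure ν := Measure.isFiniteMeasure_map _ _
  have hac : ν ≪ 𝒵.law z :=
    (withDensity_absolutelyContinuous _ _).map 𝒵.measurable_path
  have hact : ν.trim hple ≪ (𝒵.law z).trim hple := hac.trim hple
  -- The derivative is taken on the past σ-algebra only. This builds in adaptedness, but a priori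
  -- reproduces `ν` only on past events.
  set M : PathSpace S → ℝ≥0∞ := (ν.trim hple).rnDeriv ((𝒵.law z).trim hple) with hM
  have hMm : Measurable[PathSpace.past S t] M := Measure.measurable_rnDeriv _ _
  have hMm' : Measurable M := hMm.mono hple le_rfl
  have hνint : ∀ F : PathSpace S → ℝ≥0∞, Measurable F →
      ∫⁻ w, F w ∂ν = ∫⁻ ω, H ω * F (𝒵.path ω) ∂(𝒵.P z) := fun F hF => by
    rw [hν, lintegral_map hF 𝒵.measurable_path, lintegral_withDensity_eq_lintegral_mul _ hHm0
      (show Measurable fun ω => F (𝒵.path ω) from hF.comp 𝒵.measurable_path)]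
    rfl
  have hpast : ∀ Φ : PathSpace S → ℝ≥0∞, Measurable[PathSpace.past S t] Φ →
      ∫⁻ w, Φ w ∂ν = ∫⁻ w, M w * Φ w ∂(𝒵.law z) := fun Φ hΦ => by
    rw [← lintegral_trim hple hΦ, ← Measure.withDensity_rnDeriv_eq _ _ hact,
      lintegral_withDensity_eq_lintegral_mul _ hMm hΦ, lintegral_trim hple (hMm.mul hΦ)]
    rfl
  -- The weights `H` and `M ∘ path` are both `ℱ t`-measurable, so for each of them a future event
  -- may be replaced by the same past-measurable `Φ`. Agreement on the past therefore extends to the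
  -- generating past-future events.
  have key : ν = (𝒵.law z).withDensity M := by
    have hC : ∀ A ∈ PathSpace.pastFutureSets S t, ν A = (𝒵.law z).withDensity M A := by
      rintro _ ⟨B₁, B₂, h₁, h₂, rfl⟩
      have hA : MeasurableSet (B₁ ∩ PathSpace.shift t ⁻¹' B₂) :=
        (hple _ h₁).inter (PathSpace.measurable_shift t h₂)
      have hA1 : Measurable ((B₁ ∩ PathSpace.shift t ⁻¹' B₂).indicator
        (1 : PathSpace S → ℝ≥0∞)) := measurable_one.indicator hA
      obtain ⟨Φ, hΦ, hK⟩ := 𝒵.exists_past_measurable z t h₁ h₂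
      have hΦ' : Measurable Φ := hΦ.mono hple le_rfl
      rw [← lintegral_indicator_one hA, hνint _ hA1, hK H hH, ← hνint Φ hΦ', hpast Φ hΦ,
        𝒵.lintegral_law z (show Measurable fun w => M w * Φ w from hMm'.mul hΦ'), ← hK (fun ω => M (𝒵.path ω))
          (hMm.comp (𝒵.measurable_path_past t)),
        ← 𝒵.lintegral_law z (F := fun w => M w * (B₁ ∩ PathSpace.shift t ⁻¹' B₂).indicator 1 w)
          (hMm'.mul hA1), withDensity_apply _ hA, ← lintegral_indicator hA]
      refine lintegral_congr fun w => ?_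
      by_cases hw : w ∈ B₁ ∩ PathSpace.shift t ⁻¹' B₂ <;> simp only [indicator, hw] <;> simp
    exact ext_of_generate_finite _ (PathSpace.generateFrom_pastFutureSets t)
      (PathSpace.isPiSystem_pastFutureSets t) hC
      (hC univ ⟨univ, univ, MeasurableSet.univ, MeasurableSet.univ, by simp⟩)
  refine ⟨M, hMm, fun F hF => ?_⟩
  rw [← hνint F hF, key, lintegral_withDensity_eq_lintegral_mul _ hMm' hF]
  rfl

/-- The projections of an increasing sequence of bounded adapted variables can be chosen
increasing and bounded. -/
lemma exists_projection_seq (z : S) {τ : ℕ → ℝ≥0} (hτ : Monotone τ) {a : ℕ → Ω → ℝ}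
    (ham : ∀ k, Measurable[𝒵.ℱ (τ k)] (a k)) {m : ℝ} (hle : ∀ k ω, a k ω ≤ m)
    (hmono : ∀ ω, Monotone fun k => a k ω) :
    ∃ Λ : ℕ → PathSpace S → ℝ, (∀ k, Measurable[PathSpace.past S (τ k)] (Λ k)) ∧
      (∀ k w, 0 ≤ Λ k w) ∧ (∀ k w, Λ k w ≤ max m 0) ∧ (∀ w, Monotone fun k => Λ k w) ∧
      ∀ k, ∀ F : PathSpace S → ℝ≥0∞, Measurable F →
        ∫⁻ ω, ENNReal.ofReal (a k ω) * F (𝒵.path ω) ∂(𝒵.P z) =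
          ∫⁻ w, ENNReal.ofReal (Λ k w) * F w ∂(𝒵.law z) := by
  have hex := fun k => 𝒵.exists_projection z (τ k) (ham k).ennreal_ofReal
    (m := ENNReal.ofReal m) ENNReal.ofReal_ne_top
    (fun ω => ENNReal.ofReal_le_ofReal (hle k ω))
  choose M hM hMF using hex
  have hM' : ∀ k, Measurable (M k) := fun k => (hM k).mono (PathSpace.past_le _) le_rfl
  have hset : ∀ k {B : Set (PathSpace S)}, MeasurableSet B → ∫⁻ w in B, M k w ∂(𝒵.law z) =
      ∫⁻ ω, ENNReal.ofReal (a k ω) * B.indicator 1 (𝒵.path ω) ∂(𝒵.P z) := fun k B hB => by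
    rw [hMF k _ (measurable_one.indicator hB), ← lintegral_indicator hB]
    refine lintegral_congr fun w => ?_
    by_cases hw : w ∈ B <;> simp [hw]
  have hMle : ∀ k, M k ≤ᵐ[𝒵.law z] fun _ => ENNReal.ofReal m := fun k => by
    refine ae_le_of_forall_setLIntegral_le_of_sigmaFinite (hM' k) fun B hB _ => ?_
    rw [hset k hB, setLIntegral_const, ← lintegral_indicator_one hB,
      ← lintegral_const_mul _ (measurable_one.indicator hB),
      𝒵.lintegral_law z (F := fun w => ENNReal.ofReal m * B.indicator 1 w)
        (measurable_const.mul (measurable_one.indicator hB))]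
    refine lintegral_mono fun ω => ?_
    gcongr
    exact hle k ω
  have hMmono : ∀ j k, j ≤ k → M j ≤ᵐ[𝒵.law z] M k := fun j k hjk => by
    refine ae_le_of_forall_setLIntegral_le_of_sigmaFinite (hM' j) fun B hB _ => ?_
    rw [hset j hB, hset k hB]
    refine lintegral_mono fun ω => ?_
    gcongr
    exact hmono ω hjk
  -- The `M k` are ordered and bounded only almost surely. The maximum over `j ≤ k`, capped at `m`,
  -- has both properties everywhere, changes nothing almost surely, and still depends only on the
  -- path up to `τ k`.
  have hnt : ∀ k w, min (ENNReal.ofReal m) (⨆ j, ⨆ _ : j ≤ k, M j w) ≠ ⊤ := fun k w =>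
    ne_top_of_le_ne_top ENNReal.ofReal_ne_top (min_le_left _ _)
  refine ⟨fun k w => (min (ENNReal.ofReal m) (⨆ j, ⨆ _ : j ≤ k, M j w)).toReal, fun k => ?_,
    fun k w => ENNReal.toReal_nonneg, fun k w => ?_, fun w k l hkl => ?_, fun k F hF => ?_⟩
  · refine Measurable.ennreal_toReal (Measurable.min measurable_const ?_)
    exact Measurable.iSup fun j => Measurable.iSup fun hj =>
      (hM j).mono (PathSpace.past_mono (hτ hj)) le_rfl
  · refine (ENNReal.toReal_mono ENNReal.ofReal_ne_top (min_le_left _ _)).trans ?_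
    rw [ENNReal.toReal_ofReal']
  · refine ENNReal.toReal_mono (hnt l w) (min_le_min_left _ ?_)
    exact biSup_mono fun j hj => hj.trans hkl
  · rw [hMF k F hF]
    refine lintegral_congr_ae ?_
    filter_upwards [hMle k, ae_all_iff.2 fun j => ae_all_iff.2 fun hj : j ≤ k => hMmono j k hj]
      with w hw1 hw2
    rw [ENNReal.ofReal_toReal (hnt k w)]
    congr 1
    have : ⨆ j, ⨆ _ : j ≤ k, M j w = M k w :=
      le_antisymm (iSup₂_le hw2) (le_iSup₂ (f := fun j (_ : j ≤ k) => M j w) k le_rfl)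
    rw [this, min_eq_right hw1]

end RightProcess

/-! ### Minimal capital injections -/

namespace PathSpace

variable {E : Type*} [TopologicalSpace E]

/-- The least capital injection up to time `s` that keeps `X - Λ` non-negative. -/
noncomputable def shortfall (Λ : ℝ≥0 → PathSpace (ℝ × E) → ℝ) (w : PathSpace (ℝ × E)) (s : ℝ≥0) :
    ℝ≥0∞ :=
  ⨆ u ≤ s, ENNReal.ofReal (Λ u w - (w.1 u).1)

lemma ofReal_sub_le_shortfall (Λ : ℝ≥0 → PathSpace (ℝ × E) → ℝ) (w : PathSpace (ℝ × E))
    {u s : ℝ≥0} (hu : u ≤ s) : ENNReal.ofReal (Λ u w - (w.1 u).1) ≤ shortfall Λ w s :=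
  le_iSup₂ (f := fun u (_ : u ≤ s) => ENNReal.ofReal (Λ u w - (w.1 u).1)) u hu

lemma continuousWithinAt_ofReal_sub {Λ : ℝ≥0 → PathSpace (ℝ × E) → ℝ} {w : PathSpace (ℝ × E)}
    (hΛ : IsIncreasingPath fun t => Λ t w) (t : ℝ≥0) :
    ContinuousWithinAt (fun u => ENNReal.ofReal (Λ u w - (w.1 u).1)) (Ici t) t :=
  ENNReal.continuous_ofReal.continuousAt.comp_continuousWithinAt
    ((hΛ.cadlag t).1.sub (w.2 t).fst)

lemma shortfall_eq_iSup_dense {Λ : ℝ≥0 → PathSpace (ℝ × E) → ℝ} {w : PathSpace (ℝ × E)}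
    (hΛ : IsIncreasingPath fun t => Λ t w) (s : ℝ≥0) :
    shortfall Λ w s = ⨆ i, ENNReal.ofReal (Λ (min (TopologicalSpace.denseSeq ℝ≥0 i) s) w -
      (w.1 (min (TopologicalSpace.denseSeq ℝ≥0 i) s)).1) := by
  refine le_antisymm (iSup₂_le fun u hu => ?_)
    (iSup_le fun i => ofReal_sub_le_shortfall Λ w (min_le_right _ _))
  exact forall_le_mem_of_dense (continuousWithinAt_ofReal_sub hΛ) isClosed_Iic
    (fun i => le_iSup (fun i => ENNReal.ofReal (Λ (min (TopologicalSpace.denseSeq ℝ≥0 i) s) w -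
      (w.1 (min (TopologicalSpace.denseSeq ℝ≥0 i) s)).1)) i) hu

end PathSpace

/-- Conditional Jensen inequality for the shortfall. -/
lemma MarkovAdditiveProcess.lintegral_mul_shortfall_le {Ω E : Type*} [MeasurableSpace Ω]
    [TopologicalSpace E] [MeasurableSpace E] (𝒳 : MarkovAdditiveProcess Ω E) (z : ℝ × E)
    {Λ : ℝ≥0 → PathSpace (ℝ × E) → ℝ} (hΛ : ∀ w, IsIncreasingPath fun t => Λ t w)
    (hΛm : ∀ t, Measurable (Λ t)) {L : ℝ≥0 → Ω → ℝ} (hL : ∀ t, Measurable (L t))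
    (hL0 : ∀ t ω, 0 ≤ L t ω)
    (hproj : ∀ u, ∀ F : PathSpace (ℝ × E) → ℝ≥0∞, Measurable F →
      ∫⁻ ω, ENNReal.ofReal (L u ω) * F (𝒳.path ω) ∂(𝒳.P z) =
        ∫⁻ w, ENNReal.ofReal (Λ u w) * F w ∂(𝒳.law z))
    {R : Ω → ℝ} (hR : Measurable R) {s : ℝ≥0} (hR0 : ∀ ω, 0 ≤ R ω)
    (hLR : ∀ᵐ ω ∂(𝒳.P z), ∀ u ≤ s, L u ω ≤ R ω + 𝒳.X u ω)
    {F : PathSpace (ℝ × E) → ℝ≥0∞} (hF : Measurable F) (hFt : ∀ w, F w ≠ ⊤) :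
    ∫⁻ w, F w * PathSpace.shortfall Λ w s ∂(𝒳.law z) ≤
      ∫⁻ ω, F (𝒳.path ω) * ENNReal.ofReal (R ω) ∂(𝒳.P z) := by
  by_cases htop : ∫⁻ ω, F (𝒳.path ω) * ENNReal.ofReal (R ω) ∂(𝒳.P z) = ⊤
  · rw [htop]; exact le_top
  have hpath := 𝒳.measurable_path
  have hFR : Measurable fun ω => F (𝒳.path ω) * ENNReal.ofReal (R ω) :=
    (hF.comp hpath).mul hR.ennreal_ofReal
  have hfin : IsFiniteMeasure ((𝒳.P z).withDensity
    fun ω => F (𝒳.path ω) * ENNReal.ofReal (R ω)) := isFiniteMeasure_withDensity htop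
  set ρ : Measure (PathSpace (ℝ × E)) :=
    ((𝒳.P z).withDensity fun ω => F (𝒳.path ω) * ENNReal.ofReal (R ω)).map 𝒳.path with hρ
  have hfinρ : IsFiniteMeasure ρ := Measure.isFiniteMeasure_map _ _
  have hac : ρ ≪ 𝒳.law z := (withDensity_absolutelyContinuous _ _).map hpath
  -- This is `F` times the conditional expectation of `R` given the path.
  set r := ρ.rnDeriv (𝒳.law z)
  have hr : Measurable r := Measure.measurable_rnDeriv _ _
  have hrρ : ∀ B, MeasurableSet B → ∫⁻ w in B, r w ∂(𝒳.law z) =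
      ∫⁻ ω in 𝒳.path ⁻¹' B, F (𝒳.path ω) * ENNReal.ofReal (R ω) ∂(𝒳.P z) := fun B hB => by
    rw [Measure.setLIntegral_rnDeriv hac, hρ, Measure.map_apply hpath hB,
      withDensity_apply _ (hpath hB)]
  have hpt : ∀ u ≤ s, ∀ᵐ w ∂(𝒳.law z), F w * ENNReal.ofReal (Λ u w - (w.1 u).1) ≤ r w := by
    intro u hu
    have hXu : Measurable fun w : PathSpace (ℝ × E) => (w.1 u).1 :=
      (PathSpace.measurable_apply u).fst
    have hneg : Measurable fun w : PathSpace (ℝ × E) => ENNReal.ofReal (-(w.1 u).1) :=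
      hXu.neg.ennreal_ofReal
    -- The positive and negative parts of `X` are put on opposite sides to avoid truncated
    -- subtraction in `ℝ≥0∞`.
    have hle : (fun w => F w * (ENNReal.ofReal (Λ u w) + ENNReal.ofReal (-(w.1 u).1)))
        ≤ᵐ[𝒳.law z] fun w => r w + F w * ENNReal.ofReal (w.1 u).1 := by
      refine ae_le_of_forall_setLIntegral_le_of_sigmaFinite
        (hF.mul ((hΛm u).ennreal_ofReal.add hneg)) fun B hB _ => ?_
      have h1 : ∫⁻ w in B, F w * (ENNReal.ofReal (Λ u w) + ENNReal.ofReal (-(w.1 u).1))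
          ∂(𝒳.law z) = ∫⁻ ω in 𝒳.path ⁻¹' B, F (𝒳.path ω) * (ENNReal.ofReal (L u ω) +
            ENNReal.ofReal (-𝒳.X u ω)) ∂(𝒳.P z) := by
        have hBF : Measurable (B.indicator F) := hF.indicator hB
        have e1 := hproj u _ hBF
        have e2 := 𝒳.lintegral_law z (show Measurable fun w : PathSpace (ℝ × E) =>
          ENNReal.ofReal (-(w.1 u).1) * B.indicator F w from hneg.mul hBF)
        rw [← lintegral_indicator hB, ← lintegral_indicator (hpath hB)]
        calc _ = ∫⁻ w, ENNReal.ofReal (Λ u w) * B.indicator F w +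
              ENNReal.ofReal (-(w.1 u).1) * B.indicator F w ∂(𝒳.law z) := by
              refine lintegral_congr fun w => ?_
              by_cases hw : w ∈ B
              · simp only [indicator_of_mem hw]; ring
              · simp [hw]
          _ = _ := by
              rw [lintegral_add_left (show Measurable fun w => ENNReal.ofReal (Λ u w) *
                  B.indicator F w from (hΛm u).ennreal_ofReal.mul hBF), e2, ← e1,
                ← lintegral_add_left (show Measurable fun ω => ENNReal.ofReal (L u ω) *
                  B.indicator F (𝒳.path ω) from (hL u).ennreal_ofReal.mul (hBF.comp hpath))]
              refine lintegral_congr fun ω => ?_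
              by_cases hw : 𝒳.path ω ∈ B
              · have hw' : ω ∈ 𝒳.path ⁻¹' B := hw
                simp only [indicator_of_mem hw, indicator_of_mem hw']
                rw [mul_add, mul_comm, mul_comm (F (𝒳.path ω)) (ENNReal.ofReal (-𝒳.X u ω))]
                rfl
              · have hw' : ω ∉ 𝒳.path ⁻¹' B := hw
                simp [hw, hw']
      have h2 : ∫⁻ w in B, F w * ENNReal.ofReal (w.1 u).1 ∂(𝒳.law z) =
          ∫⁻ ω in 𝒳.path ⁻¹' B, F (𝒳.path ω) * ENNReal.ofReal (𝒳.X u ω) ∂(𝒳.P z) :=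
        setLIntegral_map hB (hF.mul hXu.ennreal_ofReal) hpath
      rw [h1, lintegral_add_left hr, hrρ B hB, h2, ← lintegral_add_left hFR]
      refine lintegral_mono_ae (ae_restrict_of_ae ?_)
      filter_upwards [hLR] with ω hω
      rw [← mul_add]
      have := hω u hu
      refine mul_le_mul' le_rfl ?_
      rcases le_total 0 (𝒳.X u ω) with h | h
      · rw [ENNReal.ofReal_of_nonpos (neg_nonpos.2 h), add_zero,
          ← ENNReal.ofReal_add (hR0 ω) h]
        exact ENNReal.ofReal_le_ofReal this
      · rw [ENNReal.ofReal_of_nonpos h, add_zero, ← ENNReal.ofReal_add (hL0 u ω) (neg_nonneg.2 h)]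
        exact ENNReal.ofReal_le_ofReal (by linarith)
    filter_upwards [hle] with w hw
    have hΛ0 := (hΛ w).nonneg u
    rcases le_total 0 (w.1 u).1 with h | h
    · rw [ENNReal.ofReal_of_nonpos (neg_nonpos.2 h), add_zero] at hw
      rw [ENNReal.ofReal_sub _ h, ENNReal.mul_sub fun _ _ => hFt w]
      exact tsub_le_iff_right.2 hw
    · rwa [ENNReal.ofReal_of_nonpos h, mul_zero, add_zero, ← ENNReal.ofReal_add hΛ0
        (neg_nonneg.2 h), ← sub_eq_add_neg] at hw
  have hall : ∀ᵐ w ∂(𝒳.law z), F w * PathSpace.shortfall Λ w s ≤ r w := by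
    -- The exceptional null set depends on `u`; right-continuity makes countably many `u` suffice.
    filter_upwards [ae_all_iff.2 fun i : ℕ =>
      hpt (min (TopologicalSpace.denseSeq ℝ≥0 i) s) (min_le_right _ _)] with w hw
    rw [PathSpace.shortfall_eq_iSup_dense (hΛ w), ENNReal.mul_iSup]
    exact iSup_le hw
  calc _ ≤ ∫⁻ w, r w ∂(𝒳.law z) := lintegral_mono_ae hall
    _ = _ := by
        have := hrρ univ MeasurableSet.univ
        rwa [preimage_univ, Measure.restrict_univ, Measure.restrict_univ] at this

/-! ### Strategies that depend on the path only -/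

/-- A bounded dividend strategy that is a function of the path. -/
structure PathStrategy (E : Type*) [TopologicalSpace E] [MeasurableSpace E] where
  L : ℝ≥0 → PathSpace (ℝ × E) → ℝ
  bound : ℝ
  adapted : ∀ t, Measurable[PathSpace.past (ℝ × E) t] (L t)
  path : ∀ w, IsIncreasingPath fun t => L t w
  le_bound : ∀ t w, L t w ≤ bound

lemma measurable_increasing_toNNReal {α : Type*} [MeasurableSpace α] {G : ℝ≥0 → α → ℝ}
    (hm : ∀ t, Measurable (G t)) (hG : ∀ a, IsIncreasingPath fun t => G t a) :
    Measurable fun p : α × ℝ => G p.2.toNNReal p.1 :=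
  (measurable_uncurry_of_rightCont hm fun a t => ((hG a).cadlag t).1).comp
    ((measurable_real_toNNReal.comp measurable_snd).prodMk measurable_fst)

namespace PathStrategy

variable {E : Type*} [TopologicalSpace E] [MeasurableSpace E] (Λ : PathStrategy E)

lemma measurable_L (t : ℝ≥0) : Measurable (Λ.L t) :=
  (Λ.adapted t).mono (PathSpace.past_le t) le_rfl

/-- The expected discounted dividends under the path law `μ`. -/
noncomputable def dividend (q : E → ℝ) (μ : Measure (PathSpace (ℝ × E))) : ℝ≥0∞ :=
  ∫⁻ w, (∫⁻ s in Ici (0 : ℝ), PathSpace.density q w s * ENNReal.ofReal (Λ.L s.toNNReal w)) ∂μ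

/-- The expected discounted minimal injections under the path law `μ`. -/
noncomputable def injection (q : E → ℝ) (μ : Measure (PathSpace (ℝ × E))) : ℝ≥0∞ :=
  ∫⁻ w, (∫⁻ s in Ici (0 : ℝ), PathSpace.density q w s *
    PathSpace.shortfall Λ.L w s.toNNReal) ∂μ

lemma measurable_shortfall :
    Measurable fun p : PathSpace (ℝ × E) × ℝ => PathSpace.shortfall Λ.L p.1 p.2.toNNReal := by
  simp_rw [fun p : PathSpace (ℝ × E) × ℝ =>
    PathSpace.shortfall_eq_iSup_dense (Λ.path p.1) p.2.toNNReal]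
  refine Measurable.iSup fun i => ?_
  have ht : Measurable fun p : PathSpace (ℝ × E) × ℝ =>
      (min (TopologicalSpace.denseSeq ℝ≥0 i) p.2.toNNReal, p.1) :=
    (measurable_const.min (measurable_real_toNNReal.comp measurable_snd)).prodMk measurable_fst
  have h1 := (measurable_uncurry_of_rightCont Λ.measurable_L
    fun w t => ((Λ.path w).cadlag t).1).comp ht
  have h2 := (measurable_uncurry_of_rightCont (Z := fun t (w : PathSpace (ℝ × E)) => (w.1 t).1)
    (fun t => (PathSpace.measurable_apply t).fst) fun w t => (w.2 t).fst).comp ht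
  exact (h1.sub h2).ennreal_ofReal

section Measurable

variable [BorelSpace E] [TopologicalSpace.PseudoMetrizableSpace E] {q : E → ℝ}

lemma measurable_dividend_integrand (hq : Measurable q) :
    Measurable fun p : PathSpace (ℝ × E) × ℝ =>
      PathSpace.density q p.1 p.2 * ENNReal.ofReal (Λ.L p.2.toNNReal p.1) :=
  (PathSpace.measurable_density hq).mul
    (measurable_increasing_toNNReal Λ.measurable_L Λ.path).ennreal_ofReal

lemma measurable_injection_integrand (hq : Measurable q) :
    Measurable fun p : PathSpace (ℝ × E) × ℝ =>
      PathSpace.density q p.1 p.2 * PathSpace.shortfall Λ.L p.1 p.2.toNNReal :=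
  (PathSpace.measurable_density hq).mul Λ.measurable_shortfall

lemma measurable_dividend_path (hq : Measurable q) :
    Measurable fun w : PathSpace (ℝ × E) => ∫⁻ s in Ici (0 : ℝ),
      PathSpace.density q w s * ENNReal.ofReal (Λ.L s.toNNReal w) :=
  (Λ.measurable_dividend_integrand hq).lintegral_prod_right'

lemma measurable_injection_path (hq : Measurable q) :
    Measurable fun w : PathSpace (ℝ × E) => ∫⁻ s in Ici (0 : ℝ),
      PathSpace.density q w s * PathSpace.shortfall Λ.L w s.toNNReal :=
  (Λ.measurable_injection_integrand hq).lintegral_prod_right'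

end Measurable

/-- The strategy that pays no dividends. -/
def zero (E : Type*) [TopologicalSpace E] [MeasurableSpace E] : PathStrategy E where
  L _ _ := 0
  bound := 0
  adapted _ := measurable_const
  path _ := .of_mono_rightCont (fun _ => le_rfl) monotone_const fun _ => continuousWithinAt_const
  le_bound _ _ := le_rfl

/-- Combination of strategies for paths that start at different levels. -/
def combine (Λ₁ Λ₂ : PathStrategy E) {a b : ℝ} (ha : 0 ≤ a) (hb : 0 ≤ b) (x₁ x₂ : ℝ) :
    PathStrategy E where
  L t w := a * Λ₁.L t (PathSpace.translate x₁ w) + b * Λ₂.L t (PathSpace.translate x₂ w)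
  bound := a * Λ₁.bound + b * Λ₂.bound
  adapted t := (((Λ₁.adapted t).comp (PathSpace.measurable_translate_past x₁ t)).const_mul a).add
    (((Λ₂.adapted t).comp (PathSpace.measurable_translate_past x₂ t)).const_mul b)
  path _ := .of_mono_rightCont
    (fun t => add_nonneg (mul_nonneg ha ((Λ₁.path _).nonneg t))
      (mul_nonneg hb ((Λ₂.path _).nonneg t)))
    (fun _ _ hst => add_le_add (mul_le_mul_of_nonneg_left ((Λ₁.path _).mono hst) ha)
      (mul_le_mul_of_nonneg_left ((Λ₂.path _).mono hst) hb))
    fun t => (continuousWithinAt_const.mul ((Λ₁.path _).cadlag t).1).add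
      (continuousWithinAt_const.mul ((Λ₂.path _).cadlag t).1)
  le_bound t _ := add_le_add (mul_le_mul_of_nonneg_left (Λ₁.le_bound t _) ha)
    (mul_le_mul_of_nonneg_left (Λ₂.le_bound t _) hb)

section Combine

variable {q : E → ℝ}
  (Λ₁ Λ₂ : PathStrategy E) {a b : ℝ} (ha : 0 ≤ a) (hb : 0 ≤ b) (x₁ x₂ : ℝ)
  (μ : Measure (PathSpace (ℝ × E)))

lemma _root_.lintegral_translate_combination
    {G₁ G₂ : PathSpace (ℝ × E) → ℝ → ℝ≥0∞}
    (h₁ : Measurable fun p : PathSpace (ℝ × E) × ℝ => G₁ p.1 p.2)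
    (h₂ : Measurable fun p : PathSpace (ℝ × E) × ℝ => G₂ p.1 p.2) :
    ∫⁻ w, (∫⁻ s in Ici (0 : ℝ), (ENNReal.ofReal a * G₁ (PathSpace.translate x₁ w) s +
      ENNReal.ofReal b * G₂ (PathSpace.translate x₂ w) s)) ∂μ =
    ENNReal.ofReal a *
      ∫⁻ w, (∫⁻ s in Ici (0 : ℝ), G₁ w s) ∂(μ.map (PathSpace.translate x₁)) +
    ENNReal.ofReal b *
      ∫⁻ w, (∫⁻ s in Ici (0 : ℝ), G₂ w s) ∂(μ.map (PathSpace.translate x₂)) := by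
  have ht := PathSpace.measurable_translate (E := E)
  have m₁ : Measurable fun w => ∫⁻ s in Ici (0 : ℝ), G₁ w s := h₁.lintegral_prod_right'
  have m₂ : Measurable fun w => ∫⁻ s in Ici (0 : ℝ), G₂ w s := h₂.lintegral_prod_right'
  have s₁ : ∀ w, Measurable (G₁ w) := fun w => h₁.comp (measurable_const.prodMk measurable_id)
  have s₂ : ∀ w, Measurable (G₂ w) := fun w => h₂.comp (measurable_const.prodMk measurable_id)
  rw [lintegral_map m₁ (ht x₁), lintegral_map m₂ (ht x₂),
    ← lintegral_const_mul _ (show Measurable fun w => ∫⁻ s in Ici (0 : ℝ),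
      G₁ (PathSpace.translate x₁ w) s from m₁.comp (ht x₁)),
    ← lintegral_const_mul _ (show Measurable fun w => ∫⁻ s in Ici (0 : ℝ),
      G₂ (PathSpace.translate x₂ w) s from m₂.comp (ht x₂)),
    ← lintegral_add_left (show Measurable fun w => ENNReal.ofReal a * ∫⁻ s in Ici (0 : ℝ),
      G₁ (PathSpace.translate x₁ w) s from (m₁.comp (ht x₁)).const_mul _)]
  refine lintegral_congr fun w => ?_
  rw [lintegral_add_left ((s₁ _).const_mul _), lintegral_const_mul _ (s₁ _),
    lintegral_const_mul _ (s₂ _)]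

variable [BorelSpace E] [TopologicalSpace.PseudoMetrizableSpace E]

lemma dividend_combine (hq : Measurable q) :
    (combine Λ₁ Λ₂ ha hb x₁ x₂).dividend q μ =
      ENNReal.ofReal a * Λ₁.dividend q (μ.map (PathSpace.translate x₁)) +
        ENNReal.ofReal b * Λ₂.dividend q (μ.map (PathSpace.translate x₂)) := by
  rw [dividend, dividend, dividend, ← lintegral_translate_combination _ _ _
    (Λ₁.measurable_dividend_integrand hq) (Λ₂.measurable_dividend_integrand hq)]
  refine lintegral_congr fun w => lintegral_congr fun s => ?_
  simp only [combine, PathSpace.density_translate]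
  rw [ENNReal.ofReal_add (mul_nonneg ha ((Λ₁.path _).nonneg _))
    (mul_nonneg hb ((Λ₂.path _).nonneg _)), ENNReal.ofReal_mul ha, ENNReal.ofReal_mul hb]
  ring

/-- Since `a + b = 1` and the shifts average to zero, the level of the path is the corresponding
average of the translated levels. The positive part is convex, and suprema are subadditive. -/
lemma injection_combine_le (hq : Measurable q) (hab : a + b = 1) (hx : a * x₁ + b * x₂ = 0) :
    (combine Λ₁ Λ₂ ha hb x₁ x₂).injection q μ ≤
      ENNReal.ofReal a * Λ₁.injection q (μ.map (PathSpace.translate x₁)) +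
        ENNReal.ofReal b * Λ₂.injection q (μ.map (PathSpace.translate x₂)) := by
  rw [injection, injection, injection, ← lintegral_translate_combination _ _ _
    (Λ₁.measurable_injection_integrand hq) (Λ₂.measurable_injection_integrand hq)]
  refine lintegral_mono fun w => lintegral_mono fun s => ?_
  simp only [PathSpace.density_translate]
  rw [mul_left_comm, mul_left_comm (ENNReal.ofReal b), ← mul_add]
  refine mul_le_mul' le_rfl (iSup₂_le fun u hu => ?_)
  have h₁ := PathSpace.ofReal_sub_le_shortfall Λ₁.L (PathSpace.translate x₁ w) hu
  have h₂ := PathSpace.ofReal_sub_le_shortfall Λ₂.L (PathSpace.translate x₂ w) hu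
  refine le_trans ?_ (add_le_add (mul_le_mul' le_rfl h₁) (mul_le_mul' le_rfl h₂))
  rw [← ENNReal.ofReal_mul ha, ← ENNReal.ofReal_mul hb]
  refine le_trans (ENNReal.ofReal_le_ofReal ?_) ENNReal.ofReal_add_le
  simp only [combine, PathSpace.translate]
  have : b = 1 - a := by linarith
  subst this
  nlinarith

end Combine

variable {Ω : Type*} [MeasurableSpace Ω] (𝒳 : MarkovAdditiveProcess Ω E)

lemma cadlag_sub (ω : Ω) : IsCadlag fun t => Λ.L t (𝒳.path ω) - 𝒳.X t ω :=
  (Λ.path _).cadlag.sub (𝒳.cadlag ω)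

/-- The strategy that pays dividends according to `Λ` and injects the least possible capital. -/
noncomputable def toStrategy : MarkovAdditiveProcess.Strategy 𝒳 where
  L t ω := Λ.L t (𝒳.path ω)
  R t ω := runningSup (fun t => Λ.L t (𝒳.path ω) - 𝒳.X t ω) t
  L_path ω := Λ.path _
  R_path ω := (Λ.cadlag_sub 𝒳 ω).isIncreasingPath_runningSup
  L_adapted t := (Λ.adapted t).comp (𝒳.measurable_path_past t)
  R_adapted t := by
    have h : ∀ ω, runningSup (fun t => Λ.L t (𝒳.path ω) - 𝒳.X t ω) t = _ := fun ω =>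
      (Λ.cadlag_sub 𝒳 ω).runningSup_eq_iSup_dense t
    simp_rw [h]
    refine Measurable.iSup fun i => Measurable.max (Measurable.sub ?_ ?_) measurable_const
    · exact ((Λ.adapted _).comp (𝒳.measurable_path_past _)).mono
        (𝒳.ℱ.mono (min_le_right _ _)) le_rfl
    · exact ((measurable_fst.comp (𝒳.adapted _))).mono (𝒳.ℱ.mono (min_le_right _ _)) le_rfl
  controlled_nonneg z := ae_of_all _ fun ω t => by
    have := (Λ.cadlag_sub 𝒳 ω).le_runningSup (le_refl t)
    linarith

lemma ofReal_toStrategy_R_le (t : ℝ≥0) (ω : Ω) :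
    ENNReal.ofReal ((Λ.toStrategy 𝒳).R t ω) ≤ PathSpace.shortfall Λ.L (𝒳.path ω) t := by
  by_cases htop : PathSpace.shortfall Λ.L (𝒳.path ω) t = ⊤
  · rw [htop]; exact le_top
  rw [ENNReal.ofReal_le_iff_le_toReal htop]
  change runningSup (fun t => Λ.L t (𝒳.path ω) - 𝒳.X t ω) t ≤ _
  refine runningSup_le ENNReal.toReal_nonneg fun u hu => ?_
  rw [← ENNReal.ofReal_le_iff_le_toReal htop]
  exact PathSpace.ofReal_sub_le_shortfall Λ.L (𝒳.path ω) hu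

lemma shortfall_le (w : PathSpace (ℝ × E)) (t : ℝ≥0) :
    PathSpace.shortfall Λ.L w t ≤ ENNReal.ofReal Λ.bound + PathSpace.supAbs w t := by
  refine iSup₂_le fun u hu => ?_
  refine le_trans ?_ (add_le_add le_rfl (PathSpace.ofReal_abs_le_supAbs w hu))
  refine le_trans (ENNReal.ofReal_le_ofReal ?_) ENNReal.ofReal_add_le
  have := neg_abs_le (w.1 u).1
  linarith [Λ.le_bound u w]

variable [BorelSpace E] [TopologicalSpace.PseudoMetrizableSpace E] {q : E → ℝ} {q₀ : ℝ}

lemma dividendValue_toStrategy (hq : Measurable q) (hq₀ : 0 < q₀) (hq₀q : ∀ y, q₀ < q y)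
    (hfin : 𝒳.HasFiniteDiscount q) (z : ℝ × E) :
    (Λ.toStrategy 𝒳).dividendValue q z = Λ.dividend q (𝒳.law z) := by
  rw [dividend, 𝒳.lintegral_law z (Λ.measurable_dividend_path hq)]
  exact MarkovAdditiveProcess.lintegral_exp_discount_eq hq hq₀ hq₀q hfin
    (Λ.toStrategy 𝒳).L_path z

lemma injectionValue_toStrategy_le (hq : Measurable q) (hq₀ : 0 < q₀) (hq₀q : ∀ y, q₀ < q y)
    (hfin : 𝒳.HasFiniteDiscount q) (z : ℝ × E) :
    (Λ.toStrategy 𝒳).injectionValue q z ≤ Λ.injection q (𝒳.law z) := by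
  rw [injection, 𝒳.lintegral_law z (Λ.measurable_injection_path hq)]
  refine (MarkovAdditiveProcess.lintegral_exp_discount_eq hq hq₀ hq₀q hfin
    (Λ.toStrategy 𝒳).R_path z).trans_le ?_
  exact lintegral_mono fun ω => lintegral_mono fun s =>
    mul_le_mul' le_rfl (Λ.ofReal_toStrategy_R_le 𝒳 _ ω)

/-- Admissibility is required under every starting law, while the dividends may have been built for
one. Their uniform bound settles this: the shortfall is at most that bound plus the running supremum
of `|X|`. -/
lemma isAdmissible_toStrategy (hM : 𝒳.HasBoundedMeanSup) (hq : Measurable q) (hq₀ : 0 < q₀)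
    (hq₀q : ∀ y, q₀ < q y) (hfin : 𝒳.HasFiniteDiscount q) :
    (Λ.toStrategy 𝒳).IsAdmissible q := fun z => by
  refine (Λ.injectionValue_toStrategy_le 𝒳 hq hq₀ hq₀q hfin z).trans_lt ?_
  rw [injection, 𝒳.lintegral_law z (Λ.measurable_injection_path hq)]
  refine lt_of_le_of_lt ?_ (𝒳.lintegral_density_mul_supAbs_lt_top hM hq₀ hq₀q hfin
    (m := ENNReal.ofReal Λ.bound) ENNReal.ofReal_ne_top z)
  exact lintegral_mono fun ω => lintegral_mono fun s => mul_le_mul' le_rfl (Λ.shortfall_le _ _)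

end PathStrategy

/-! ### Approximation of general strategies by path strategies -/

namespace MarkovAdditiveProcess

variable {Ω E : Type*} [MeasurableSpace Ω] [TopologicalSpace E] [MeasurableSpace E]
  {𝒳 : MarkovAdditiveProcess Ω E} {q : E → ℝ} {q₀ β : ℝ}

lemma Strategy.measurable_L (π : Strategy 𝒳) (t : ℝ≥0) : Measurable (π.L t) :=
  (π.L_adapted t).mono (𝒳.ℱ.le t) le_rfl

lemma Strategy.measurable_R (π : Strategy 𝒳) (t : ℝ≥0) : Measurable (π.R t) :=
  (π.R_adapted t).mono (𝒳.ℱ.le t) le_rfl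

section

variable [BorelSpace E] [TopologicalSpace.PseudoMetrizableSpace E]

lemma measurable_density_path (hq : Measurable q) :
    Measurable fun p : Ω × ℝ => PathSpace.density q (𝒳.path p.1) p.2 :=
  (PathSpace.measurable_density hq).comp
    ((𝒳.measurable_path.comp measurable_fst).prodMk measurable_snd)

lemma measurable_density_mul (hq : Measurable q) {G : ℝ≥0 → Ω → ℝ} (hm : ∀ t, Measurable (G t))
    (hG : ∀ ω, IsIncreasingPath fun t => G t ω) :
    Measurable fun p : Ω × ℝ => PathSpace.density q (𝒳.path p.1) p.2 *
      ENNReal.ofReal (G p.2.toNNReal p.1) :=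
  (measurable_density_path hq).mul (measurable_increasing_toNNReal hm hG).ennreal_ofReal

/-- Monotone convergence of expected discounted dividends. -/
lemma tendsto_lintegral_density_mul (hq : Measurable q) {G : ℕ → ℝ≥0 → Ω → ℝ} {L : ℝ≥0 → Ω → ℝ}
    (hm : ∀ n t, Measurable (G n t)) (hG : ∀ n ω, IsIncreasingPath fun t => G n t ω)
    (hmono : ∀ t ω, Monotone fun n => G n t ω)
    (hlim : ∀ ω, ∀ᵐ s : ℝ, 0 < s →
      Tendsto (fun n => G n s.toNNReal ω) atTop (𝓝 (L s.toNNReal ω))) (z : ℝ × E) :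
    Tendsto (fun n => ∫⁻ ω, (∫⁻ s in Ici (0 : ℝ), PathSpace.density q (𝒳.path ω) s *
        ENNReal.ofReal (G n s.toNNReal ω)) ∂(𝒳.P z)) atTop
      (𝓝 (∫⁻ ω, (∫⁻ s in Ici (0 : ℝ), PathSpace.density q (𝒳.path ω) s *
        ENNReal.ofReal (L s.toNNReal ω)) ∂(𝒳.P z))) := by
  have hjm := fun n => measurable_density_mul (𝒳 := 𝒳) hq (hm n) (hG n)
  refine lintegral_tendsto_of_tendsto_of_monotone
    (fun n => (hjm n).lintegral_prod_right'.aemeasurable)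
    (ae_of_all _ fun ω i j hij => lintegral_mono fun s =>
      mul_le_mul' le_rfl (ENNReal.ofReal_le_ofReal (hmono _ ω hij))) (ae_of_all _ fun ω => ?_)
  refine lintegral_tendsto_of_tendsto_of_monotone
    (fun n => ((hjm n).comp (measurable_const.prodMk measurable_id)).aemeasurable)
    (ae_of_all _ fun s i j hij =>
      mul_le_mul' le_rfl (ENNReal.ofReal_le_ofReal (hmono _ ω hij))) ?_
  -- Time `0` is discarded: dividends collected on a grid vanish there even when `L 0 > 0`.
  rw [← restrict_Ioi_eq_restrict_Ici]
  filter_upwards [ae_restrict_of_ae (hlim ω), ae_restrict_mem measurableSet_Ioi] with s hs hs0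
  exact ENNReal.Tendsto.const_mul (ENNReal.tendsto_ofReal (hs hs0)) (.inr ENNReal.ofReal_ne_top)

lemma Strategy.dividendValue_eq (π : Strategy 𝒳) (hq : Measurable q) (hq₀ : 0 < q₀)
    (hq₀q : ∀ y, q₀ < q y) (hfin : 𝒳.HasFiniteDiscount q) (z : ℝ × E) :
    π.dividendValue q z = ∫⁻ ω, (∫⁻ s in Ici (0 : ℝ), PathSpace.density q (𝒳.path ω) s *
      ENNReal.ofReal (π.L s.toNNReal ω)) ∂(𝒳.P z) :=
  lintegral_exp_discount_eq hq hq₀ hq₀q hfin π.L_path z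

lemma Strategy.injectionValue_eq (π : Strategy 𝒳) (hq : Measurable q) (hq₀ : 0 < q₀)
    (hq₀q : ∀ y, q₀ < q y) (hfin : 𝒳.HasFiniteDiscount q) (z : ℝ × E) :
    π.injectionValue q z = ∫⁻ ω, (∫⁻ s in Ici (0 : ℝ), PathSpace.density q (𝒳.path ω) s *
      ENNReal.ofReal (π.R s.toNNReal ω)) ∂(𝒳.P z) :=
  lintegral_exp_discount_eq hq hq₀ hq₀q hfin π.R_path z

/-- The upper bound `E_z ∫ sup_{u ≤ s} |X_u| q(Y_s) e^{-𝔮(s)} ds` for the value. -/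
noncomputable def valueBound (𝒳 : MarkovAdditiveProcess Ω E) (q : E → ℝ) (z : ℝ × E) : ℝ≥0∞ :=
  ∫⁻ ω, (∫⁻ s in Ici (0 : ℝ), PathSpace.density q (𝒳.path ω) s *
    (0 + PathSpace.supAbs (𝒳.path ω) s.toNNReal)) ∂(𝒳.P z)

/-- Pathwise `L ≤ R + X ≤ R + sup |X|`, integrated against the discounting measure. -/
lemma Strategy.dividendValue_le (π : Strategy 𝒳) (hq : Measurable q) (hq₀ : 0 < q₀)
    (hq₀q : ∀ y, q₀ < q y) (hfin : 𝒳.HasFiniteDiscount q) (z : ℝ × E) :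
    π.dividendValue q z ≤ π.injectionValue q z + 𝒳.valueBound q z := by
  rw [π.dividendValue_eq hq hq₀ hq₀q hfin, π.injectionValue_eq hq hq₀ hq₀q hfin, valueBound]
  have hjm := measurable_density_mul (𝒳 := 𝒳) hq π.measurable_R π.R_path
  rw [← lintegral_add_left hjm.lintegral_prod_right']
  refine lintegral_mono_ae ?_
  filter_upwards [π.controlled_nonneg z] with ω hω
  rw [← lintegral_add_left (show Measurable fun s : ℝ => PathSpace.density q (𝒳.path ω) s *
    ENNReal.ofReal (π.R s.toNNReal ω) from hjm.comp (measurable_const.prodMk measurable_id))]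
  refine lintegral_mono fun s => ?_
  rw [zero_add]
  rw [← mul_add]
  refine mul_le_mul' le_rfl ?_
  refine le_trans ?_ (add_le_add le_rfl
    (PathSpace.ofReal_abs_le_supAbs (𝒳.path ω) (le_refl s.toNNReal)))
  refine le_trans (ENNReal.ofReal_le_ofReal ?_) ENNReal.ofReal_add_le
  have h1 := hω s.toNNReal
  have h2 : 𝒳.X s.toNNReal ω ≤ |((𝒳.path ω).1 s.toNNReal).1| := le_abs_self _
  linarith

/-- Every strategy is approximated by strategies that depend on the path only. -/
lemma Strategy.exists_pathStrategy (π : Strategy 𝒳) (hq : Measurable q) (hq₀ : 0 < q₀)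
    (hq₀q : ∀ y, q₀ < q y) (hfin : 𝒳.HasFiniteDiscount q) (z : ℝ × E) (n : ℕ) :
    ∃ Λ : PathStrategy E,
      Λ.dividend q (𝒳.law z) = ∫⁻ ω, (∫⁻ s in Ici (0 : ℝ), PathSpace.density q (𝒳.path ω) s *
        ENNReal.ofReal (min (n : ℝ) (π.L (gridTime n (gridIndex n s.toNNReal)) ω))) ∂(𝒳.P z) ∧
      Λ.injection q (𝒳.law z) ≤ π.injectionValue q z := by
  -- Sampling on the grid leaves countably many variables to project, so monotone versions exist;
  -- truncation at `n` provides the bound needed for projection and admissibility.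
  set a : ℕ → Ω → ℝ := fun k ω => min (n : ℝ) (π.L (gridTime n k) ω) with ha
  have ha0 : ∀ k ω, 0 ≤ a k ω := fun k ω => le_min n.cast_nonneg ((π.L_path ω).nonneg _)
  have hamono : ∀ ω, Monotone fun k => a k ω := fun ω k l hkl =>
    min_le_min_left _ ((π.L_path ω).mono (gridTime_mono n hkl))
  have ham : ∀ k, Measurable[𝒳.ℱ (gridTime n k)] (a k) := fun k =>
    measurable_const.min (π.L_adapted _)
  obtain ⟨Λ, hΛm, hΛ0, hΛle, hΛmono, hΛF⟩ := 𝒳.exists_projection_seq z (gridTime_mono n) ham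
    (m := n) (fun k ω => min_le_left _ _) hamono
  let Γ : PathStrategy E :=
    { L := fun t w => Λ (gridIndex n t) w
      bound := max n 0
      adapted := fun t => (hΛm _).mono (PathSpace.past_mono (gridTime_gridIndex_le n t)) le_rfl
      path := fun w => isIncreasingPath_gridIndex n (fun k => hΛ0 k w) (hΛmono w)
      le_bound := fun t w => hΛle _ w }
  have hLm : ∀ t : ℝ≥0, Measurable fun ω => a (gridIndex n t) ω := fun t =>
    (ham _).mono (𝒳.ℱ.le _) le_rfl
  have hLpath : ∀ ω, IsIncreasingPath fun t => a (gridIndex n t) ω := fun ω =>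
    isIncreasingPath_gridIndex n (fun k => ha0 k ω) (hamono ω)
  have hdens : ∀ s : ℝ, Measurable fun w : PathSpace (ℝ × E) => PathSpace.density q w s :=
    fun s => (PathSpace.measurable_density hq).comp (measurable_id.prodMk measurable_const)
  refine ⟨Γ, ?_, ?_⟩
  · rw [PathStrategy.dividend,
      lintegral_lintegral_swap (Γ.measurable_dividend_integrand hq).aemeasurable,
      lintegral_lintegral_swap (f := fun ω s => PathSpace.density q (𝒳.path ω) s *
        ENNReal.ofReal (min (n : ℝ) (π.L (gridTime n (gridIndex n s.toNNReal)) ω)))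
        (measurable_density_mul (𝒳 := 𝒳) hq hLm hLpath).aemeasurable]
    refine lintegral_congr fun s => ?_
    -- For fixed `s` the density is a functional of the path, to which the projection identity
    -- applies.
    have h := hΛF (gridIndex n s.toNNReal) _ (hdens s)
    simp only [mul_comm (PathSpace.density q _ s)]
    exact h.symm
  · rw [π.injectionValue_eq hq hq₀ hq₀q hfin, PathStrategy.injection,
      lintegral_lintegral_swap (Γ.measurable_injection_integrand hq).aemeasurable,
      lintegral_lintegral_swap (f := fun ω s => PathSpace.density q (𝒳.path ω) s *
        ENNReal.ofReal (π.R s.toNNReal ω))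
        (measurable_density_mul (𝒳 := 𝒳) hq π.measurable_R π.R_path).aemeasurable]
    refine lintegral_mono fun s => ?_
    refine 𝒳.lintegral_mul_shortfall_le z Γ.path Γ.measurable_L hLm (fun t ω => ha0 _ ω)
      (fun u F hF => hΛF _ F hF) (π.measurable_R _) (fun ω => (π.R_path ω).nonneg _) ?_
      (hdens s) fun w => ENNReal.ofReal_ne_top
    filter_upwards [π.controlled_nonneg z] with ω hω u hu
    have h1 : a (gridIndex n u) ω ≤ π.L u ω :=
      (min_le_right _ _).trans ((π.L_path ω).mono (gridTime_gridIndex_le n u))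
    have h2 := hω u
    have h3 : π.R u ω ≤ π.R s.toNNReal ω := (π.R_path ω).mono hu
    linarith

lemma Strategy.tendsto_truncated_dividend (π : Strategy 𝒳) (hq : Measurable q) (hq₀ : 0 < q₀)
    (hq₀q : ∀ y, q₀ < q y) (hfin : 𝒳.HasFiniteDiscount q) (z : ℝ × E) :
    Tendsto (fun n : ℕ => ∫⁻ ω, (∫⁻ s in Ici (0 : ℝ), PathSpace.density q (𝒳.path ω) s *
      ENNReal.ofReal (min (n : ℝ) (π.L (gridTime n (gridIndex n s.toNNReal)) ω))) ∂(𝒳.P z)) atTop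
      (𝓝 (π.dividendValue q z)) := by
  rw [π.dividendValue_eq hq hq₀ hq₀q hfin]
  refine tendsto_lintegral_density_mul hq
    (G := fun n t ω => min (n : ℝ) (π.L (gridTime n (gridIndex n t)) ω))
    (fun n t => measurable_const.min (π.measurable_L _))
    (fun n ω => isIncreasingPath_gridIndex n
      (fun k => le_min n.cast_nonneg ((π.L_path ω).nonneg (gridTime n k)))
      (fun k l hkl => min_le_min_left _ ((π.L_path ω).mono (gridTime_mono n hkl))))
    (fun t ω => monotone_nat_of_le_succ fun n => min_le_min (by simp)
      ((π.L_path ω).mono (gridTime_gridIndex_le_succ n t))) (fun ω => ?_) z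
  filter_upwards [ae_tendsto_gridTime (π.L_path ω).mono] with s hs _
  refine hs.congr' ?_
  obtain ⟨N, hN⟩ := exists_nat_ge (π.L s.toNNReal ω)
  filter_upwards [eventually_ge_atTop N] with n hn
  refine (min_eq_right ?_).symm
  exact ((π.L_path ω).mono (gridTime_gridIndex_le n _)).trans
    (hN.trans (by exact_mod_cast hn))

end

end MarkovAdditiveProcess

/-! ### Periodic strategies on dyadic grids -/

lemma renewalTime_const {Ω : Type*} (n k : ℕ) (ω : Ω) :
    renewalTime (fun _ _ => ((2 : ℝ≥0) ^ n)⁻¹) k ω = gridTime n k := by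
  simp [renewalTime, gridTime]

lemma renewalCount_const {Ω : Type*} (n : ℕ) (t : ℝ≥0) (ω : Ω) :
    renewalCount (fun _ _ => ((2 : ℝ≥0) ^ n)⁻¹) t ω = gridIndex n t := by
  have : {k | renewalTime (fun _ _ => ((2 : ℝ≥0) ^ n)⁻¹) k ω ≤ t} = Iic (gridIndex n t) := by
    ext k; simp [renewalTime_const, le_gridIndex_iff]
  rw [renewalCount, this, csSup_Iic]

lemma gridIndex_eq_half (n : ℕ) (t : ℝ≥0) : gridIndex n t = gridIndex (n + 1) t / 2 := by
  refine eq_of_forall_le_iff fun k => ?_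
  rw [Nat.le_div_iff_mul_le two_pos, le_gridIndex_iff, le_gridIndex_iff, mul_comm, gridTime_two_mul]

lemma gridTime_zero (n : ℕ) : gridTime n 0 = 0 := by simp [gridTime]

/-- Coarse grid times are the fine ones of even index; payments are indexed from `1`, whence the
shifts. -/
lemma sum_range_even_succ (g : ℕ → ℝ) (N : ℕ) :
    ∑ k ∈ Finset.range N, (if Even (k + 1) then g ((k + 1) / 2) else 0) =
      ∑ k ∈ Finset.range (N / 2), g (k + 1) := by
  induction N with
  | zero => simp
  | succ N ih =>
    rw [Finset.sum_range_succ, ih]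
    split_ifs with h
    · obtain ⟨r, hr⟩ := h
      have h1 : (N + 1) / 2 = N / 2 + 1 := by omega
      rw [h1, Finset.sum_range_succ]
    · rw [Nat.not_even_iff_odd] at h
      obtain ⟨r, hr⟩ := h
      have h1 : (N + 1) / 2 = N / 2 := by omega
      rw [h1, add_zero]

namespace MarkovAdditiveProcess

variable {Ω E : Type*} [MeasurableSpace Ω] [TopologicalSpace E] [MeasurableSpace E]
  {𝒳 : MarkovAdditiveProcess Ω E} {q : E → ℝ} {q₀ β : ℝ}

/-- A strategy that is periodic on a dyadic grid is periodic on the next finer one. -/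
lemma Strategy.IsPeriodic.refine_dyadic {π : Strategy 𝒳} {n : ℕ}
    (h : π.IsPeriodic fun _ _ => (2 ^ n)⁻¹) : π.IsPeriodic fun _ _ => (2 ^ (n + 1))⁻¹ := by
  classical
  obtain ⟨ℓ, hm, h0, hL⟩ := h
  -- Payments off the coarse grid are suppressed; this condition on `t` is deterministic, so
  -- adaptedness is kept.
  refine ⟨fun t ω => if ∃ k, t = gridTime n k then ℓ t ω else 0, fun t => ?_, fun t ω => ?_,
    fun z => ?_⟩
  · by_cases ht : ∃ k, t = gridTime n k
    · simpa only [ht, if_true] using hm t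
    · simpa only [ht, if_false] using measurable_const
  · dsimp only
    split_ifs
    exacts [h0 t ω, le_rfl]
  · filter_upwards [hL z] with ω hω t
    rw [hω t]
    simp only [renewalCount_const, renewalTime_const]
    rw [gridIndex_eq_half, ← sum_range_even_succ (fun k => ℓ (gridTime n k) ω)]
    refine Finset.sum_congr rfl fun k _ => ?_
    have hiff : (∃ j, gridTime (n + 1) (k + 1) = gridTime n j) ↔ Even (k + 1) := by
      constructor
      · rintro ⟨j, hj⟩
        rw [← gridTime_two_mul n, (gridTime_injective _).eq_iff] at hj
        exact ⟨j, by omega⟩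
      · rintro ⟨j, hj⟩
        exact ⟨j, by rw [← gridTime_two_mul n, hj, two_mul]⟩
    by_cases he : Even (k + 1)
    · rw [if_pos he, if_pos (hiff.2 he)]
      obtain ⟨j, hj⟩ := he
      rw [← gridTime_two_mul n]
      congr 2
      omega
    · rw [if_neg he, if_neg (mt hiff.1 he)]

/-- The dividends of `π` collected at the grid times `2⁻ⁿ, 2 · 2⁻ⁿ, …`. -/
noncomputable def Strategy.collected (π : Strategy 𝒳) (n : ℕ) (k : ℕ) (ω : Ω) : ℝ :=
  -- The first admissible payment time is `2⁻ⁿ`, so an initial dividend `L 0` is deferred to it.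
  if k = 0 then 0 else π.L (gridTime n k) ω

lemma Strategy.collected_nonneg (π : Strategy 𝒳) (n k : ℕ) (ω : Ω) : 0 ≤ π.collected n k ω := by
  unfold collected
  split_ifs
  exacts [le_rfl, (π.L_path ω).nonneg _]

lemma Strategy.collected_le (π : Strategy 𝒳) (n k : ℕ) (ω : Ω) :
    π.collected n k ω ≤ π.L (gridTime n k) ω := by
  unfold collected
  split_ifs
  exacts [(π.L_path ω).nonneg _, le_rfl]

lemma Strategy.collected_mono (π : Strategy 𝒳) (n : ℕ) (ω : Ω) :
    Monotone fun k => π.collected n k ω := fun k l hkl => by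
  dsimp only
  by_cases hk : k = 0
  · rw [collected, if_pos hk]; exact π.collected_nonneg _ _ _
  · have hl : l ≠ 0 := by omega
    rw [collected, collected, if_neg hk, if_neg hl]
    exact (π.L_path ω).mono (gridTime_mono n hkl)

lemma Strategy.measurable_collected (π : Strategy 𝒳) (n k : ℕ) :
    Measurable[𝒳.ℱ (gridTime n k)] (π.collected n k) := by
  by_cases hk : k = 0
  · have : π.collected n k = fun _ => 0 := by ext ω; rw [collected, if_pos hk]
    rw [this]; exact measurable_const
  · have : π.collected n k = π.L (gridTime n k) := by ext ω; rw [collected, if_neg hk]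
    rw [this]; exact π.L_adapted _

lemma Strategy.collected_gridIndex_le (π : Strategy 𝒳) (n : ℕ) (t : ℝ≥0) (ω : Ω) :
    π.collected n (gridIndex n t) ω ≤ π.L t ω :=
  (π.collected_le _ _ _).trans ((π.L_path ω).mono (gridTime_gridIndex_le n t))

/-- The strategy that pays the dividends of `π` at the next grid time. -/
noncomputable def Strategy.dyadic (π : Strategy 𝒳) (n : ℕ) : Strategy 𝒳 where
  L t ω := π.collected n (gridIndex n t) ω
  R := π.R
  L_path ω := isIncreasingPath_gridIndex n (fun k => π.collected_nonneg n k ω)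
    (π.collected_mono n ω)
  R_path := π.R_path
  L_adapted t := (π.measurable_collected n _).mono
    (𝒳.ℱ.mono (gridTime_gridIndex_le n t)) le_rfl
  R_adapted := π.R_adapted
  controlled_nonneg z := by
    filter_upwards [π.controlled_nonneg z] with ω hω t
    linarith [hω t, π.collected_gridIndex_le n t ω]

lemma Strategy.isPeriodic_dyadic (π : Strategy 𝒳) (n : ℕ) :
    (π.dyadic n).IsPeriodic fun _ _ => (2 ^ n)⁻¹ := by
  -- At grid times `ℓ` is the amount accumulated since the previous one, so the payments telescope.
  -- Elsewhere only adaptedness and non-negativity matter.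
  refine ⟨fun t ω => π.L t ω - π.collected n (gridIndex n t - 1) ω, fun t => ?_, fun t ω => ?_,
    fun z => ae_of_all _ fun ω t => ?_⟩
  · exact (π.L_adapted t).sub ((π.measurable_collected n _).mono
      (𝒳.ℱ.mono ((gridTime_mono n (Nat.sub_le _ 1)).trans (gridTime_gridIndex_le n t))) le_rfl)
  · exact sub_nonneg.2 ((π.collected_mono n ω (Nat.sub_le _ 1)).trans
      (π.collected_gridIndex_le n t ω))
  · simp only [renewalCount_const, renewalTime_const, gridIndex_gridTime, Nat.add_sub_cancel]
    have h : ∀ k, π.L (gridTime n (k + 1)) ω = π.collected n (k + 1) ω := fun k => by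
      rw [collected, if_neg k.succ_ne_zero]
    simp_rw [h]
    rw [Finset.sum_range_sub (fun k => π.collected n k ω)]
    simp [dyadic, collected]

lemma valueBound_lt_top (hM : 𝒳.HasBoundedMeanSup) (hq₀ : 0 < q₀)
    (hq₀q : ∀ y, q₀ < q y) (hfin : 𝒳.HasFiniteDiscount q) (z : ℝ × E) :
    𝒳.valueBound q z < ⊤ :=
  𝒳.lintegral_density_mul_supAbs_lt_top hM hq₀ hq₀q hfin ENNReal.zero_ne_top z

lemma isPeriodic_zero (r : ℕ → Ω → ℝ≥0) :
    ((PathStrategy.zero E).toStrategy 𝒳).IsPeriodic r :=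
  ⟨fun _ _ => 0, fun _ => measurable_const, fun _ _ => le_rfl, fun _ => ae_of_all _ fun _ _ => by
    simp [PathStrategy.toStrategy, PathStrategy.zero]⟩

lemma dyadicValue_le_classicalValue (n : ℕ) (z : ℝ × E) :
    𝒳.dyadicValue q β n z ≤ 𝒳.classicalValue q β z :=
  biSup_mono fun _ hπ => hπ.1

lemma monotone_dyadicValue (z : ℝ × E) : Monotone fun n => 𝒳.dyadicValue q β n z :=
  monotone_nat_of_le_succ fun _ => biSup_mono fun _ hπ => ⟨hπ.1, hπ.2.refine_dyadic⟩

section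

variable [BorelSpace E] [TopologicalSpace.PseudoMetrizableSpace E]

lemma Strategy.tendsto_dividendValue_dyadic (π : Strategy 𝒳) (hq : Measurable q) (hq₀ : 0 < q₀)
    (hq₀q : ∀ y, q₀ < q y) (hfin : 𝒳.HasFiniteDiscount q) (z : ℝ × E) :
    Tendsto (fun n => (π.dyadic n).dividendValue q z) atTop (𝓝 (π.dividendValue q z)) := by
  rw [π.dividendValue_eq hq hq₀ hq₀q hfin]
  simp_rw [fun n => (π.dyadic n).dividendValue_eq hq hq₀ hq₀q hfin z]
  refine tendsto_lintegral_density_mul hq (G := fun n => (π.dyadic n).L)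
    (fun n t => (π.dyadic n).measurable_L t) (fun n => (π.dyadic n).L_path)
    (fun t ω => monotone_nat_of_le_succ fun n => ?_) (fun ω => ?_) z
  · by_cases h : gridIndex n t = 0
    · simp only [dyadic, h]
      rw [collected, if_pos rfl]
      exact π.collected_nonneg _ _ _
    · have h' : gridIndex (n + 1) t ≠ 0 := by
        have := gridIndex_eq_half n t; omega
      simp only [dyadic, collected, if_neg h, if_neg h']
      exact (π.L_path ω).mono (gridTime_gridIndex_le_succ n t)
  · filter_upwards [ae_tendsto_gridTime (π.L_path ω).mono] with s hs hs0
    refine hs.congr' ?_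
    have hpos : (0 : ℝ≥0) < s.toNNReal := Real.toNNReal_pos.2 hs0
    filter_upwards [(tendsto_gridTime_gridIndex s.toNNReal).eventually (Ioi_mem_nhds hpos)]
      with n hn
    have hne : gridIndex n s.toNNReal ≠ 0 := fun h => by
      rw [h, gridTime_zero] at hn; exact lt_irrefl _ hn
    simp only [dyadic, collected, if_neg hne]

/-! ### Value functions -/

/-- The net present value as a real number. -/
noncomputable def Strategy.realNpv (π : Strategy 𝒳) (q : E → ℝ) (β : ℝ) (z : ℝ × E) : ℝ :=
  (π.dividendValue q z).toReal - β * (π.injectionValue q z).toReal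

lemma Strategy.dividendValue_lt_top {π : Strategy 𝒳} (hπ : π.IsAdmissible q)
    (hM : 𝒳.HasBoundedMeanSup) (hq : Measurable q) (hq₀ : 0 < q₀)
    (hq₀q : ∀ y, q₀ < q y) (hfin : 𝒳.HasFiniteDiscount q) (z : ℝ × E) :
    π.dividendValue q z < ⊤ :=
  (π.dividendValue_le hq hq₀ hq₀q hfin z).trans_lt
    (ENNReal.add_lt_top.2 ⟨hπ z, valueBound_lt_top hM hq₀ hq₀q hfin z⟩)

lemma Strategy.npv_eq_realNpv {π : Strategy 𝒳} (hπ : π.IsAdmissible q)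
    (hM : 𝒳.HasBoundedMeanSup) (hq : Measurable q) (hq₀ : 0 < q₀)
    (hq₀q : ∀ y, q₀ < q y) (hfin : 𝒳.HasFiniteDiscount q) (z : ℝ × E) :
    π.npv q β z = (π.realNpv q β z : EReal) := by
  rw [npv, realNpv, ← EReal.coe_ennreal_toReal (hπ z).ne,
    ← EReal.coe_ennreal_toReal (dividendValue_lt_top hπ hM hq hq₀ hq₀q hfin z).ne]
  push_cast
  rfl

/-- With `β > 1`, injections cost at least the extra dividends they can finance. -/
lemma Strategy.realNpv_le {π : Strategy 𝒳} (hπ : π.IsAdmissible q)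
    (hM : 𝒳.HasBoundedMeanSup) (hq : Measurable q) (hq₀ : 0 < q₀)
    (hq₀q : ∀ y, q₀ < q y) (hfin : 𝒳.HasFiniteDiscount q) (hβ : 1 < β) (z : ℝ × E) :
    π.realNpv q β z ≤ (𝒳.valueBound q z).toReal := by
  have hB := valueBound_lt_top hM hq₀ hq₀q hfin z
  have h := ENNReal.toReal_mono (ENNReal.add_lt_top.2 ⟨hπ z, hB⟩).ne
    (π.dividendValue_le hq hq₀ hq₀q hfin z)
  rw [ENNReal.toReal_add (hπ z).ne hB.ne] at h
  have h0 : 0 ≤ (π.injectionValue q z).toReal := ENNReal.toReal_nonneg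
  unfold realNpv
  nlinarith

lemma classicalValue_ne_top (hM : 𝒳.HasBoundedMeanSup) (hq : Measurable q) (hq₀ : 0 < q₀)
    (hq₀q : ∀ y, q₀ < q y) (hfin : 𝒳.HasFiniteDiscount q) (hβ : 1 < β) (z : ℝ × E) :
    𝒳.classicalValue q β z ≠ ⊤ := by
  refine ne_top_of_le_ne_top (EReal.coe_ne_top (𝒳.valueBound q z).toReal) (iSup₂_le fun π hπ => ?_)
  rw [Strategy.npv_eq_realNpv hπ hM hq hq₀ hq₀q hfin z]
  exact EReal.coe_le_coe_iff.2 (Strategy.realNpv_le hπ hM hq hq₀ hq₀q hfin hβ z)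

lemma dyadicValue_ne_bot (hM : 𝒳.HasBoundedMeanSup) (hq : Measurable q) (hq₀ : 0 < q₀)
    (hq₀q : ∀ y, q₀ < q y) (hfin : 𝒳.HasFiniteDiscount q) (n : ℕ) (z : ℝ × E) :
    𝒳.dyadicValue q β n z ≠ ⊥ := by
  have hadm := (PathStrategy.zero E).isAdmissible_toStrategy 𝒳 hM hq hq₀ hq₀q hfin
  have h : ((PathStrategy.zero E).toStrategy 𝒳).npv q β z ≤ 𝒳.dyadicValue q β n z :=
    le_iSup₂ (f := fun (π : Strategy 𝒳) (_ : π ∈ 𝒳.periodicStrategies q fun _ _ => (2 ^ n)⁻¹) =>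
      π.npv q β z) _ ⟨hadm, isPeriodic_zero _⟩
  rw [Strategy.npv_eq_realNpv hadm hM hq hq₀ hq₀q hfin z] at h
  exact ne_bot_of_le_ne_bot (EReal.coe_ne_bot _) h

lemma tendsto_dyadicValue (hM : 𝒳.HasBoundedMeanSup) (hq : Measurable q) (hq₀ : 0 < q₀)
    (hq₀q : ∀ y, q₀ < q y) (hfin : 𝒳.HasFiniteDiscount q) (z : ℝ × E) :
    Tendsto (fun n => 𝒳.dyadicValue q β n z) atTop (𝓝 (𝒳.classicalValue q β z)) := by
  have h : 𝒳.classicalValue q β z = ⨆ n, 𝒳.dyadicValue q β n z := by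
    refine le_antisymm (iSup₂_le fun π hπ => ?_)
      (iSup_le fun n => dyadicValue_le_classicalValue n z)
    -- The injections are literally those of `π`.
    have hadm : ∀ n, (π.dyadic n).IsAdmissible q := fun n => hπ
    have hlim : Tendsto (fun n => ((π.dyadic n).realNpv q β z : EReal)) atTop
        (𝓝 (π.realNpv q β z : EReal)) := by
      refine EReal.tendsto_coe.2 (Tendsto.sub_const ?_ _)
      exact (ENNReal.tendsto_toReal
        (Strategy.dividendValue_lt_top hπ hM hq hq₀ hq₀q hfin z).ne).comp
        (π.tendsto_dividendValue_dyadic hq hq₀ hq₀q hfin z)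
    rw [Strategy.npv_eq_realNpv hπ hM hq hq₀ hq₀q hfin z]
    refine le_of_tendsto hlim (.of_forall fun n => ?_)
    rw [← Strategy.npv_eq_realNpv (hadm n) hM hq hq₀ hq₀q hfin z]
    refine le_trans ?_ (le_iSup _ n)
    exact le_iSup₂ (f := fun (π : Strategy 𝒳)
      (_ : π ∈ 𝒳.periodicStrategies q fun _ _ => (2 ^ n)⁻¹) => π.npv q β z) _
      ⟨hadm n, π.isPeriodic_dyadic n⟩
  rw [h]
  exact tendsto_atTop_iSup (monotone_dyadicValue z)

lemma classicalValue_ne_bot (hM : 𝒳.HasBoundedMeanSup) (hq : Measurable q) (hq₀ : 0 < q₀)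
    (hq₀q : ∀ y, q₀ < q y) (hfin : 𝒳.HasFiniteDiscount q) (z : ℝ × E) :
    𝒳.classicalValue q β z ≠ ⊥ :=
  ne_bot_of_le_ne_bot (dyadicValue_ne_bot hM hq hq₀ hq₀q hfin 0 z)
    (dyadicValue_le_classicalValue 0 z)

lemma Strategy.realNpv_le_classicalValue {π : Strategy 𝒳} (hπ : π.IsAdmissible q)
    (hM : 𝒳.HasBoundedMeanSup) (hq : Measurable q) (hq₀ : 0 < q₀)
    (hq₀q : ∀ y, q₀ < q y) (hfin : 𝒳.HasFiniteDiscount q) (hβ : 1 < β) (z : ℝ × E) :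
    π.realNpv q β z ≤ (𝒳.classicalValue q β z).toReal := by
  rw [← EReal.coe_le_coe_iff, EReal.coe_toReal (classicalValue_ne_top hM hq hq₀ hq₀q hfin hβ z)
    (classicalValue_ne_bot hM hq hq₀ hq₀q hfin z), ← npv_eq_realNpv hπ hM hq hq₀ hq₀q hfin z]
  exact le_iSup₂ (f := fun (π : Strategy 𝒳) (_ : π ∈ 𝒳.classicalStrategies q) => π.npv q β z) π hπ

lemma exists_lt_realNpv (hM : 𝒳.HasBoundedMeanSup) (hq : Measurable q) (hq₀ : 0 < q₀)
    (hq₀q : ∀ y, q₀ < q y) (hfin : 𝒳.HasFiniteDiscount q) (hβ : 1 < β) (z : ℝ × E) {c : ℝ}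
    (hc : c < (𝒳.classicalValue q β z).toReal) :
    ∃ π : Strategy 𝒳, π.IsAdmissible q ∧ c < π.realNpv q β z := by
  have h : (c : EReal) < 𝒳.classicalValue q β z := by
    rw [← EReal.coe_toReal (classicalValue_ne_top hM hq hq₀ hq₀q hfin hβ z)
      (classicalValue_ne_bot hM hq hq₀ hq₀q hfin z)]
    exact EReal.coe_lt_coe_iff.2 hc
  obtain ⟨π, hlt⟩ := lt_iSup_iff.1 h
  obtain ⟨hπ, hlt⟩ := lt_iSup_iff.1 hlt
  rw [Strategy.npv_eq_realNpv hπ hM hq hq₀ hq₀q hfin z] at hlt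
  exact ⟨π, hπ, EReal.coe_lt_coe_iff.1 hlt⟩

/-- Both strategies are replaced by path strategies, which are translated to the common level `x`
and averaged. Dividends converge as `n → ∞`, whereas for injections the bound by the original cost,
valid at every `n`, is enough. -/
lemma combination_realNpv_le (hM : 𝒳.HasBoundedMeanSup) (hq : Measurable q) (hq₀ : 0 < q₀)
    (hq₀q : ∀ y, q₀ < q y) (hfin : 𝒳.HasFiniteDiscount q) (hβ : 1 < β) {π₁ π₂ : Strategy 𝒳}
    (hπ₁ : π₁.IsAdmissible q) (hπ₂ : π₂.IsAdmissible q) (y : E) {x₁ x₂ a b : ℝ}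
    (ha : 0 ≤ a) (hb : 0 ≤ b) (hab : a + b = 1) :
    a * π₁.realNpv q β (x₁, y) + b * π₂.realNpv q β (x₂, y) ≤
      (𝒳.classicalValue q β (a * x₁ + b * x₂, y)).toReal := by
  have hβ0 : 0 ≤ β := by linarith
  set x := a * x₁ + b * x₂ with hx
  choose Λ₁ hD₁ hI₁ using π₁.exists_pathStrategy hq hq₀ hq₀q hfin (x₁, y)
  choose Λ₂ hD₂ hI₂ using π₂.exists_pathStrategy hq hq₀ hq₀q hfin (x₂, y)
  have ht₁ : Tendsto (fun n => (Λ₁ n).dividend q (𝒳.law (x₁, y))) atTop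
      (𝓝 (π₁.dividendValue q (x₁, y))) := by
    simp_rw [hD₁]; exact π₁.tendsto_truncated_dividend hq hq₀ hq₀q hfin _
  have ht₂ : Tendsto (fun n => (Λ₂ n).dividend q (𝒳.law (x₂, y))) atTop
      (𝓝 (π₂.dividendValue q (x₂, y))) := by
    simp_rw [hD₂]; exact π₂.tendsto_truncated_dividend hq hq₀ hq₀q hfin _
  have hfin₁ := (Strategy.dividendValue_lt_top hπ₁ hM hq hq₀ hq₀q hfin (x₁, y)).ne
  have hfin₂ := (Strategy.dividendValue_lt_top hπ₂ hM hq hq₀ hq₀q hfin (x₂, y)).ne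
  have hlim := ((((ENNReal.tendsto_toReal hfin₁).comp ht₁).sub_const
      (β * (π₁.injectionValue q (x₁, y)).toReal)).const_mul a).add
    ((((ENNReal.tendsto_toReal hfin₂).comp ht₂).sub_const
      (β * (π₂.injectionValue q (x₂, y)).toReal)).const_mul b)
  refine le_of_tendsto hlim ?_
  have hev₁ := ht₁.eventually_ne hfin₁
  have hev₂ := ht₂.eventually_ne hfin₂
  filter_upwards [hev₁, hev₂] with n hn₁ hn₂
  -- Shifting by `xᵢ - x` carries the path law from level `x` to level `xᵢ`, and these shifts
  -- average to zero.
  set Λ := PathStrategy.combine (Λ₁ n) (Λ₂ n) ha hb (x₁ - x) (x₂ - x)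
  have hadm := Λ.isAdmissible_toStrategy 𝒳 hM hq hq₀ hq₀q hfin
  refine le_trans ?_
    (Strategy.realNpv_le_classicalValue hadm hM hq hq₀ hq₀q hfin hβ (x, y))
  have hdiv : ((Λ.toStrategy 𝒳).dividendValue q (x, y)).toReal =
      a * ((Λ₁ n).dividend q (𝒳.law (x₁, y))).toReal +
        b * ((Λ₂ n).dividend q (𝒳.law (x₂, y))).toReal := by
    rw [Λ.dividendValue_toStrategy 𝒳 hq hq₀ hq₀q hfin, PathStrategy.dividend_combine _ _ _ _ _ _ _ hq,
      𝒳.map_translate_law, 𝒳.map_translate_law,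
      ENNReal.toReal_add (ENNReal.mul_ne_top ENNReal.ofReal_ne_top hn₁)
        (ENNReal.mul_ne_top ENNReal.ofReal_ne_top hn₂), ENNReal.toReal_mul, ENNReal.toReal_mul,
      ENNReal.toReal_ofReal ha, ENNReal.toReal_ofReal hb]
  have hinj : ((Λ.toStrategy 𝒳).injectionValue q (x, y)).toReal ≤
      a * (π₁.injectionValue q (x₁, y)).toReal + b * (π₂.injectionValue q (x₂, y)).toReal := by
    have h1 := Λ.injectionValue_toStrategy_le 𝒳 hq hq₀ hq₀q hfin (x, y)
    have h2 := PathStrategy.injection_combine_le (Λ₁ n) (Λ₂ n) ha hb (x₁ - x) (x₂ - x)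
      (𝒳.law (x, y)) hq hab (by rw [hx]; linear_combination (-a * x₁ - b * x₂) * hab)
    rw [𝒳.map_translate_law, 𝒳.map_translate_law] at h2
    have h3 := h1.trans (h2.trans (add_le_add (mul_le_mul' le_rfl (hI₁ n))
      (mul_le_mul' le_rfl (hI₂ n))))
    have e₁ := ENNReal.mul_ne_top (ENNReal.ofReal_ne_top (r := a)) (hπ₁ (x₁, y)).ne
    have e₂ := ENNReal.mul_ne_top (ENNReal.ofReal_ne_top (r := b)) (hπ₂ (x₂, y)).ne
    have h4 := ENNReal.toReal_mono (ENNReal.add_ne_top.2 ⟨e₁, e₂⟩) h3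
    rwa [ENNReal.toReal_add e₁ e₂, ENNReal.toReal_mul, ENNReal.toReal_mul,
      ENNReal.toReal_ofReal ha, ENNReal.toReal_ofReal hb] at h4
  rw [Strategy.realNpv, hdiv]
  have := mul_le_mul_of_nonneg_left hinj hβ0
  simp only [Function.comp_apply]
  linarith

lemma concaveOn_classicalValue (hM : 𝒳.HasBoundedMeanSup) (hq : Measurable q) (hq₀ : 0 < q₀)
    (hq₀q : ∀ y, q₀ < q y) (hfin : 𝒳.HasFiniteDiscount q) (hβ : 1 < β) (y : E) :
    ConcaveOn ℝ univ fun x : ℝ => (𝒳.classicalValue q β (x, y)).toReal := by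
  refine ⟨convex_univ, fun x₁ _ x₂ _ a b ha hb hab => ?_⟩
  simp only [smul_eq_mul]
  refine le_of_forall_pos_le_add fun ε hε => ?_
  obtain ⟨π₁, hπ₁, h₁⟩ := exists_lt_realNpv hM hq hq₀ hq₀q hfin hβ (x₁, y)
    (sub_lt_self (𝒳.classicalValue q β (x₁, y)).toReal hε)
  obtain ⟨π₂, hπ₂, h₂⟩ := exists_lt_realNpv hM hq hq₀ hq₀q hfin hβ (x₂, y)
    (sub_lt_self (𝒳.classicalValue q β (x₂, y)).toReal hε)
  have h := combination_realNpv_le hM hq hq₀ hq₀q hfin hβ hπ₁ hπ₂ y (x₁ := x₁) (x₂ := x₂) ha hb hab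
  have e₁ := mul_le_mul_of_nonneg_left h₁.le ha
  have e₂ := mul_le_mul_of_nonneg_left h₂.le hb
  have e₃ : (a + b) * ε = ε := by rw [hab, one_mul]
  linarith

end

end MarkovAdditiveProcess

theorem mainTheorem8 {Ω E : Type*} [MeasurableSpace Ω] [TopologicalSpace E] [MeasurableSpace E]
    [BorelSpace E] (hE : IsRadonSpace E)
    (𝒳 : MarkovAdditiveProcess Ω E) (hM : 𝒳.HasBoundedMeanSup)
    (q : E → ℝ) (hq : Measurable q) (q₀ : ℝ) (hq₀ : 0 < q₀) (hq₀q : ∀ y, q₀ < q y)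
    (hfin : 𝒳.HasFiniteDiscount q) (β : ℝ) (hβ : 1 < β) :
    (∀ (x : ℝ) (y : E),
      (∀ n, 𝒳.dyadicValue q β n (x, y) ≠ ⊥ ∧ 𝒳.dyadicValue q β n (x, y) ≠ ⊤) ∧
      (𝒳.classicalValue q β (x, y) ≠ ⊥ ∧ 𝒳.classicalValue q β (x, y) ≠ ⊤) ∧
      Monotone (fun n => 𝒳.dyadicValue q β n (x, y)) ∧
      Tendsto (fun n => 𝒳.dyadicValue q β n (x, y)) atTop (𝓝 (𝒳.classicalValue q β (x, y)))) ∧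
    ∀ y : E, ConcaveOn ℝ univ (fun x : ℝ => (𝒳.classicalValue q β (x, y)).toReal) := by
  have := hE.metrizableSpace
  have htop := fun z => MarkovAdditiveProcess.classicalValue_ne_top hM hq hq₀ hq₀q hfin hβ z
  refine ⟨fun x y => ⟨fun n => ⟨?_, ?_⟩, ⟨?_, htop _⟩, ?_, ?_⟩, fun y => ?_⟩
  · exact MarkovAdditiveProcess.dyadicValue_ne_bot hM hq hq₀ hq₀q hfin n _
  · exact ne_top_of_le_ne_top (htop _) (MarkovAdditiveProcess.dyadicValue_le_classicalValue n _)
  · exact MarkovAdditiveProcess.classicalValue_ne_bot hM hq hq₀ hq₀q hfin _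
  · exact MarkovAdditiveProcess.monotone_dyadicValue _
  · exact MarkovAdditiveProcess.tendsto_dyadicValue hM hq hq₀ hq₀q hfin _
  · exact MarkovAdditiveProcess.concaveOn_classicalValue hM hq hq₀ hq₀q hfin hβ y
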